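/- Let $\Lambda$ be an artin algebra, $\mathrm{mod}\text{-}\Lambda$ the category of finitely generated $\Lambda$-modules, $n\ge 2$ an integer and $\mathcal M$ an $n$-cluster tilting subcategory of $\mathrm{mod}\text{-}\Lambda$, i.e. a full, functorially finite, generating and cogenerating subcategory with $$\mathcal M=\{X:\operatorname{Ext}^i_\Lambda(\mathcal M,X)=0,\ 0<i<n\}=\{X:\operatorname{Ext}^i_\Lambda(X,\mathcal M)=0,\ 0<i<n\}.$$ Let $\mathrm{mod}\text{-}\mathcal M$ be the category of finitely presented additive functors $\mathcal M^{\mathrm{op}}\to \mathrm{Ab}$, let $\mathrm{mod}\text{-}\underline{\mathcal M}$ be its full subcategory of functors that vanish on projective $\Lambda$-modules, and let $\widetilde{\mathcal P}^{\le 1}(\mathcal M)$ be its full subcategory of functors of projective dimension at most one, with stable category $\underline{\widetilde{\mathcal P}^{\le 1}(\mathcal M)}$ (the quotient by the morphisms that factor through projective objects of $\mathrm{mod}\text{-}\mathcal M$). Let $F_{\mathcal M}$ denote the exact structure on $\mathrm{mod}\text{-}\Lambda$ whose conflations are the $\mathcal M$-proper short exact sequences, i.e. those that remain exact under $\operatorname{Hom}_\Lambda(N,-)$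 for all $N\in\mathcal M$. Let $\overleftarrow{\mathcal M}^{\le 1}$ be the full subcategory of $\mathrm{mod}\text{-}\Lambda$ of all modules $X$ that admit an $\mathcal M$-proper exact sequence $0\to M_1\to M_0\to X\to 0$ with $M_0,M_1\in\mathcal M$, and $\underline{\overleftarrow{\mathcal M}^{\le 1}}_{F_{\mathcal M}}$ its stable category with respect to the exact structure induced by $F_{\mathcal M}$ (the quotient by the morphisms that factor through relative projective objects). Then there are equivalences of categories $$\mathrm{mod}\text{-}\underline{\mathcal M}\;\simeq\;\underline{\widetilde{\mathcal P}^{\le 1}(\mathcal M)}\;\simeq\;\underline{\overleftarrow{\mathcal M}^{\le 1}}_{F_{\mathcal M}}.$$ If $n=2$, then $\overleftarrow{\mathcal M}^{\le 1}=\mathrm{mod}\text{-}\Lambda$, and there are equivalences $$\mathrm{mod}\text{-}\underline{\mathcal M}\;\simeq\;\underline{\widetilde{\mathcal P}^{\le 1}(\mathcal M)}\;\simeq\;\underline{\mathrm{mod}\text{-}\Lambda}_{F_{\mathcal M}},$$ where $\underline{\mathrm{mod}\text{-}\Lambda}_{F_{\mathcal M}}$ is the quotient of $\mathrm{mod}\text{-}\Lambda$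 by the morphisms that factor through $F_{\mathcal M}$-projective modules. -/

import Mathlib

open CategoryTheory CategoryTheory.Limits Opposite

universe v u w

namespace ClusterTilting

/-! ### `n`-cluster tilting subcategories of an abelian category

Full subcategories are given by properties of objects. -/

section Tilting

variable {A : Type u} [Category.{v} A]

/-- `π : N ⟶ X` is a right `M`-approximation of `X`. -/
def IsRightApproximation (M : ObjectProperty A) {N X : A} (π : N ⟶ X) : Prop :=
  M N ∧ ∀ ⦃N' : A⦄, M N' → ∀ g : N' ⟶ X, ∃ h : N' ⟶ N, h ≫ π = g

/-- `ι : X ⟶ N` is a left `M`-approximation of `X`. -/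
def IsLeftApproximation (M : ObjectProperty A) {X N : A} (ι : X ⟶ N) : Prop :=
  M N ∧ ∀ ⦃N' : A⦄, M N' → ∀ g : X ⟶ N', ∃ h : N ⟶ N', ι ≫ h = g

/-- Contravariantly finite and covariantly finite. -/
structure IsFunctoriallyFinite (M : ObjectProperty A) : Prop where
  contravariantly_finite : ∀ X : A, ∃ (N : A) (π : N ⟶ X), IsRightApproximation M π
  covariantly_finite : ∀ X : A, ∃ (N : A) (ι : X ⟶ N), IsLeftApproximation M ι

/-- Every object is a quotient of an object of `M`. -/
def IsGenerating (M : ObjectProperty A) : Prop :=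
  ∀ X : A, ∃ (N : A) (π : N ⟶ X), M N ∧ Epi π

/-- Every object is a subobject of an object of `M`. -/
def IsCogenerating (M : ObjectProperty A) : Prop :=
  ∀ X : A, ∃ (N : A) (ι : X ⟶ N), M N ∧ Mono ι

variable [Abelian A]

/-- `Ext^i(X, Y) = 0` in the abelian category `A`. -/
def ExtVanishes (X Y : A) (i : ℕ) : Prop :=
  letI := HasExt.standard A
  Subsingleton (Abelian.Ext.{max u v} X Y i)

/-- The objects `X` with `Ext^i(M, X) = 0` for all `0 < i < n`. -/
def rightPerp (n : ℕ) (M : ObjectProperty A) : ObjectProperty A :=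
  fun X => ∀ ⦃N : A⦄, M N → ∀ i : ℕ, 0 < i → i < n → ExtVanishes N X i

/-- The objects `X` with `Ext^i(X, M) = 0` for all `0 < i < n`. -/
def leftPerp (n : ℕ) (M : ObjectProperty A) : ObjectProperty A :=
  fun X => ∀ ⦃N : A⦄, M N → ∀ i : ℕ, 0 < i → i < n → ExtVanishes X N i

/-- `M` is an `n`-cluster tilting subcategory of the abelian category `A`. (The last two conditions
imply that `M` is closed under isomorphisms, finite direct sums and direct summands.) -/
structure IsClusterTilting (n : ℕ) (M : ObjectProperty A) : Prop where
  functoriallyFinite : IsFunctoriallyFinite M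
  generating : IsGenerating M
  cogenerating : IsCogenerating M
  rightPerp_eq : rightPerp n M = M
  leftPerp_eq : leftPerp n M = M

end Tilting

/-! ### Stable categories -/

section Stable

variable {D : Type u} [Category.{v} D] [Preadditive D]

/-- The group of morphisms `X ⟶ Y` in the ideal generated by the objects of `K`: finite sums of
morphisms that factor through an object of `K`. -/
def factorIdeal (K : ObjectProperty D) (X Y : D) : AddSubgroup (X ⟶ Y) :=
  AddSubgroup.closure {f | ∃ (Z : D) (a : X ⟶ Z) (b : Z ⟶ Y), K Z ∧ a ≫ b = f}

lemma comp_mem_factorIdeal (K : ObjectProperty D) {X Y Z : D} (f : X ⟶ Y) {g : Y ⟶ Z}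
    (hg : g ∈ factorIdeal K Y Z) : f ≫ g ∈ factorIdeal K X Z := by
  induction hg using AddSubgroup.closure_induction with
  | mem x hx =>
    obtain ⟨W, a, b, hW, rfl⟩ := hx
    exact AddSubgroup.subset_closure ⟨W, f ≫ a, b, hW, by simp⟩
  | zero => simp [zero_mem]
  | add x y _ _ hx hy => rw [Preadditive.comp_add]; exact add_mem hx hy
  | neg x _ hx => rw [Preadditive.comp_neg]; exact neg_mem hx

lemma mem_factorIdeal_comp (K : ObjectProperty D) {X Y Z : D} {f : X ⟶ Y} (g : Y ⟶ Z)
    (hf : f ∈ factorIdeal K X Y) : f ≫ g ∈ factorIdeal K X Z := by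
  induction hf using AddSubgroup.closure_induction with
  | mem x hx =>
    obtain ⟨W, a, b, hW, rfl⟩ := hx
    exact AddSubgroup.subset_closure ⟨W, a, b ≫ g, hW, by simp⟩
  | zero => simp [zero_mem]
  | add x y _ _ hx hy => rw [Preadditive.add_comp]; exact add_mem hx hy
  | neg x _ hx => rw [Preadditive.neg_comp]; exact neg_mem hx

/-- Congruence modulo the ideal generated by the objects of `K`. -/
def factorRel (K : ObjectProperty D) : HomRel D :=
  fun X Y f g => f - g ∈ factorIdeal K X Y

instance (K : ObjectProperty D) : Congruence (factorRel K) where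
  equivalence :=
    { refl := fun f => by simp [factorRel, zero_mem]
      symm := fun {f g} h => by
        have := neg_mem h
        rwa [neg_sub] at this
      trans := fun {f g k} h h' => by
        have := add_mem h h'
        rwa [sub_add_sub_cancel] at this }
  comp_left f _ _ h := by
    have := comp_mem_factorIdeal K f h
    rwa [Preadditive.comp_sub] at this
  comp_right g h := by
    have := mem_factorIdeal_comp K g h
    rwa [Preadditive.sub_comp] at this

variable (D) in
/-- The quotient of `D` by the ideal generated by the objects of `K`; it is the stable category
of `D` when `K` is the class of (relative) projective objects. -/
abbrev StableCategory (K : ObjectProperty D) := CategoryTheory.Quotient (factorRel K)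

end Stable

/-! ### Functor categories -/

section Functors

variable (C : Type u) [Category.{v} C] [Preadditive C]

/-- The finitely presented right `C`-modules: additive functors `F : Cᵒᵖ ⥤ Ab` with an exact
sequence `C(-, X) ⟶ C(-, Y) ⟶ F ⟶ 0`. -/
def isFinitelyPresented : ObjectProperty (Cᵒᵖ ⥤ AddCommGrpCat.{v}) :=
  fun F => F.Additive ∧
    ∃ (X Y : C) (φ : preadditiveYoneda.obj X ⟶ preadditiveYoneda.obj Y)
      (p : preadditiveYoneda.obj Y ⟶ F) (hp : φ ≫ p = 0),
      (ShortComplex.mk φ p hp).Exact ∧ Epi p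

/-- `mod-C`, the category of finitely presented right `C`-modules. -/
abbrev FPMod := (isFinitelyPresented C).FullSubcategory

variable {C} in
/-- The finitely presented right `C`-modules of projective dimension at most one: those `F` with
an exact sequence `0 ⟶ P₁ ⟶ P₀ ⟶ F ⟶ 0`, where `P₁` and `P₀` are projective objects of `mod-C`. -/
def projDimLEOne : ObjectProperty (FPMod C) :=
  fun F => ∃ (P₁ P₀ : FPMod C) (i : P₁.obj ⟶ P₀.obj) (p : P₀.obj ⟶ F.obj) (hp : i ≫ p = 0),
    Projective P₁ ∧ Projective P₀ ∧ (ShortComplex.mk i p hp).ShortExact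

/-- The stable category of the category of finitely presented right `C`-modules of projective
dimension at most one, modulo the morphisms factoring through projective objects of `mod-C`. -/
abbrev StableProjDimLEOne :=
  StableCategory (projDimLEOne (C := C)).FullSubcategory (fun F => Projective F.obj)

variable {A : Type u} [Category.{v} A] [Preadditive A]

/-- The functors in `mod-M` that vanish on the projective objects of `A` belonging to `M`. -/
def vanishesOnProjectives (M : ObjectProperty A) : ObjectProperty (FPMod M.FullSubcategory) :=
  fun F => ∀ P : M.FullSubcategory, Projective P.obj → IsZero (F.obj.obj (op P))

/-- The category of all functors in `mod-M` that vanish on projectives. It is identified with the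
category of finitely presented modules over the stable category of `M`. -/
abbrev ModStable (M : ObjectProperty A) := (vanishesOnProjectives M).FullSubcategory

end Functors

/-! ### The exact structure of `M`-proper short exact sequences -/

section Proper

variable {A : Type u} [Category.{v} A] [Preadditive A]

/-- `M`-proper short exact sequences: those remaining exact under `Hom(N, -)` for `N` in `M`.
They are the conflations of the exact structure `F_M` on `A`. -/
def IsProperShortExact (M : ObjectProperty A) (S : ShortComplex A) : Prop :=
  S.ShortExact ∧ ∀ ⦃N : A⦄, M N → ∀ x : N ⟶ S.X₃, ∃ y : N ⟶ S.X₂, y ≫ S.g = x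

/-- The objects `X` of proper `M`-dimension at most one: those with an `M`-proper exact sequence
`0 ⟶ M₁ ⟶ M₀ ⟶ X ⟶ 0` with `M₁` and `M₀` in `M`. -/
def properDimLEOne (M : ObjectProperty A) : ObjectProperty A :=
  fun X => ∃ (M₁ M₀ : A) (i : M₁ ⟶ M₀) (p : M₀ ⟶ X) (hp : i ≫ p = 0),
    M M₁ ∧ M M₀ ∧ IsProperShortExact M (ShortComplex.mk i p hp)

/-- The objects `P` that are projective relative to the `M`-proper short exact sequences all of
whose terms lie in the full subcategory `E`. -/
def relativeProjective (M E : ObjectProperty A) : ObjectProperty A :=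
  fun P => ∀ S : ShortComplex A, IsProperShortExact M S → E S.X₁ → E S.X₂ → E S.X₃ →
    ∀ x : P ⟶ S.X₃, ∃ y : P ⟶ S.X₂, y ≫ S.g = x

/-- The `F_M`-relative stable category of `A`. -/
abbrev RelativeStable (M : ObjectProperty A) := StableCategory A (relativeProjective M ⊤)

/-- The stable category of the category of objects of proper `M`-dimension at most one, with
respect to the exact structure induced by `F_M`: the conflations are the `M`-proper short exact
sequences whose terms have proper `M`-dimension at most one. -/
abbrev StableProperDimLEOne (M : ObjectProperty A) :=
  StableCategory (properDimLEOne M).FullSubcategory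
    (fun X => relativeProjective M (properDimLEOne M) X.obj)

end Proper

end ClusterTilting

/-! All the categories in question are compared with the factor category of `properDimLEOne M`
modulo maps through `M`.

On the functor side, `M` is generating and its right approximations are epimorphisms, so the
restricted Yoneda functor `X ↦ Hom(-, X)|_M` is fully faithful on the whole abelian category. It
identifies `M` with the projectives of mod-`M` (`projective_iff`) and `properDimLEOne M` with the
functors of projective dimension at most one (`projDimLEOne_iff`). The objects of `M` are also
exactly the relative projectives there (`relativeProjective_iff`), which gives the second
equivalence.

For mod of the stable category, a finitely presented functor vanishes on projectives iff its
presenting map is epi, so it is the defect of a short exact sequence `0 → X → M₁ → M₀ → 0` with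
`M₁`, `M₀` in `M`. The left terms `X` are the objects of `leftPerp (n - 1) M`, and a map of
sequences is zero on defects iff it is zero on left terms modulo `M`
(`nonempty_modStable_equivalence_leftPerp`).

Finally, `properDimLEOne M` equals `rightPerp (n - 1) M`, and taking cosyzygies `n - 2` times turns
it into `leftPerp (n - 1) M` modulo `M` (`nonempty_rightPerp_equivalence_leftPerp`). For `n = 2`
both orthogonals are the whole category.

Each comparison with a left or right term has the same form: two functors out of a category of short
exact sequences are full, essentially surjective and identify the same maps
(`nonempty_equivalence_of_full_of_essSurj`). -/

namespace ClusterTilting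

/-! ### Vanishing of Ext along short exact sequences -/

section ExtVanishing

variable {A : Type u} [Category.{v} A] [Abelian A]

open Abelian

lemma exists_lift_of_extVanishes {S : ShortComplex A} (hS : S.ShortExact) {N : A}
    (h : ExtVanishes N S.X₁ 1) (x : N ⟶ S.X₃) : ∃ y : N ⟶ S.X₂, y ≫ S.g = x := by
  let := HasExt.standard A
  have h' : Subsingleton (Ext.{max u v} N S.X₁ 1) := h
  obtain ⟨y, hy⟩ := Ext.covariant_sequence_exact₃ N hS (Ext.mk₀ x) (zero_add 1)
    (Subsingleton.elim _ _)
  obtain ⟨y, rfl⟩ := Ext.homEquiv₀.symm.surjective y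
  refine ⟨y, Ext.homEquiv₀.symm.injective ?_⟩
  simpa using hy

lemma exists_extension_of_extVanishes {S : ShortComplex A} (hS : S.ShortExact) {N : A}
    (h : ExtVanishes S.X₃ N 1) (x : S.X₁ ⟶ N) : ∃ y : S.X₂ ⟶ N, S.f ≫ y = x := by
  let := HasExt.standard A
  have h' : Subsingleton (Ext.{max u v} S.X₃ N 1) := h
  obtain ⟨y, hy⟩ := Ext.contravariant_sequence_exact₁ hS N (Ext.mk₀ x) (add_zero 1)
    (Subsingleton.elim _ _)
  obtain ⟨y, rfl⟩ := Ext.homEquiv₀.symm.surjective y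
  refine ⟨y, Ext.homEquiv₀.symm.injective ?_⟩
  simpa using hy

/-- The connecting map from `Hom(N, S.X₃)` is onto because `Ext¹(N, S.X₂)` vanishes, and zero
because every map lifts. This is what makes kernels of right approximations orthogonal to `M` in
degree one. -/
lemma extVanishes_one_of_lift {S : ShortComplex A} (hS : S.ShortExact) {N : A}
    (h : ExtVanishes N S.X₂ 1) (hl : ∀ x : N ⟶ S.X₃, ∃ y : N ⟶ S.X₂, y ≫ S.g = x) :
    ExtVanishes N S.X₁ 1 := by
  let := HasExt.standard A
  have h' : Subsingleton (Ext.{max u v} N S.X₂ 1) := h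
  refine subsingleton_of_forall_eq 0 fun e => ?_
  obtain ⟨x, rfl⟩ := Ext.covariant_sequence_exact₁ N hS e (Subsingleton.elim _ _) (zero_add 1)
  obtain ⟨x, rfl⟩ := Ext.homEquiv₀.symm.surjective x
  obtain ⟨y, rfl⟩ := hl x
  simp [← Ext.mk₀_comp_mk₀]

lemma extVanishes_one_of_extension {S : ShortComplex A} (hS : S.ShortExact) {N : A}
    (h : ExtVanishes S.X₂ N 1) (hl : ∀ x : S.X₁ ⟶ N, ∃ y : S.X₂ ⟶ N, S.f ≫ y = x) :
    ExtVanishes S.X₃ N 1 := by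
  let := HasExt.standard A
  have h' : Subsingleton (Ext.{max u v} S.X₂ N 1) := h
  refine subsingleton_of_forall_eq 0 fun e => ?_
  obtain ⟨x, rfl⟩ := Ext.contravariant_sequence_exact₃ hS N e (Subsingleton.elim _ _) (add_zero 1)
  obtain ⟨x, rfl⟩ := Ext.homEquiv₀.symm.surjective x
  obtain ⟨y, rfl⟩ := hl x
  simp [← Ext.mk₀_comp_mk₀]

lemma extVanishes_X₃ {S : ShortComplex A} (hS : S.ShortExact) {N : A} {i : ℕ}
    (h₂ : ExtVanishes N S.X₂ i) (h₁ : ExtVanishes N S.X₁ (i + 1)) : ExtVanishes N S.X₃ i := by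
  let := HasExt.standard A
  have h₂' : Subsingleton (Ext.{max u v} N S.X₂ i) := h₂
  have h₁' : Subsingleton (Ext.{max u v} N S.X₁ (i + 1)) := h₁
  refine subsingleton_of_forall_eq 0 fun e => ?_
  obtain ⟨x, rfl⟩ := Ext.covariant_sequence_exact₃ N hS e rfl (Subsingleton.elim _ _)
  rw [Subsingleton.elim x 0, Ext.zero_comp]

lemma extVanishes_X₁ {S : ShortComplex A} (hS : S.ShortExact) {N : A} {i : ℕ}
    (h₃ : ExtVanishes N S.X₃ i) (h₂ : ExtVanishes N S.X₂ (i + 1)) :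
    ExtVanishes N S.X₁ (i + 1) := by
  let := HasExt.standard A
  have h₃' : Subsingleton (Ext.{max u v} N S.X₃ i) := h₃
  have h₂' : Subsingleton (Ext.{max u v} N S.X₂ (i + 1)) := h₂
  refine subsingleton_of_forall_eq 0 fun e => ?_
  obtain ⟨x, rfl⟩ := Ext.covariant_sequence_exact₁ N hS e (Subsingleton.elim _ _) rfl
  rw [Subsingleton.elim x 0, Ext.zero_comp]

lemma extVanishes_X₁' {S : ShortComplex A} (hS : S.ShortExact) {N : A} {i : ℕ}
    (h₂ : ExtVanishes S.X₂ N i) (h₃ : ExtVanishes S.X₃ N (i + 1)) : ExtVanishes S.X₁ N i := by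
  let := HasExt.standard A
  have h₂' : Subsingleton (Ext.{max u v} S.X₂ N i) := h₂
  have h₃' : Subsingleton (Ext.{max u v} S.X₃ N (i + 1)) := h₃
  refine subsingleton_of_forall_eq 0 fun e => ?_
  obtain ⟨x, rfl⟩ := Ext.contravariant_sequence_exact₁ hS N e (add_comm 1 i)
    (Subsingleton.elim _ _)
  rw [Subsingleton.elim x 0, Ext.comp_zero]

lemma extVanishes_X₃' {S : ShortComplex A} (hS : S.ShortExact) {N : A} {i : ℕ}
    (h₁ : ExtVanishes S.X₁ N i) (h₂ : ExtVanishes S.X₂ N (i + 1)) :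
    ExtVanishes S.X₃ N (i + 1) := by
  let := HasExt.standard A
  have h₁' : Subsingleton (Ext.{max u v} S.X₁ N i) := h₁
  have h₂' : Subsingleton (Ext.{max u v} S.X₂ N (i + 1)) := h₂
  refine subsingleton_of_forall_eq 0 fun e => ?_
  obtain ⟨x, rfl⟩ := Ext.contravariant_sequence_exact₃ hS N e (Subsingleton.elim _ _)
    (add_comm 1 i)
  rw [Subsingleton.elim x 0, Ext.comp_zero]

lemma extVanishes_X₂ {S : ShortComplex A} (hS : S.ShortExact) {N : A} {i : ℕ}
    (h₁ : ExtVanishes N S.X₁ i) (h₃ : ExtVanishes N S.X₃ i) : ExtVanishes N S.X₂ i := by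
  let := HasExt.standard A
  have h₁' : Subsingleton (Ext.{max u v} N S.X₁ i) := h₁
  have h₃' : Subsingleton (Ext.{max u v} N S.X₃ i) := h₃
  refine subsingleton_of_forall_eq 0 fun e => ?_
  obtain ⟨x, rfl⟩ := Ext.covariant_sequence_exact₂ N hS e (Subsingleton.elim _ _)
  rw [Subsingleton.elim x 0, Ext.zero_comp]

lemma extVanishes_of_retract {X Y : A} (r : Retract X Y) {N : A} {i : ℕ}
    (h : ExtVanishes N Y i) : ExtVanishes N X i := by
  let := HasExt.standard A
  have h' : Subsingleton (Ext.{max u v} N Y i) := h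
  refine subsingleton_of_forall_eq 0 fun e => ?_
  have : (e.comp (Ext.mk₀ r.i) (add_zero i)).comp (Ext.mk₀ r.r) (add_zero i) = e := by
    rw [Ext.comp_assoc_of_third_deg_zero, Ext.mk₀_comp_mk₀, r.retract, Ext.comp_mk₀_id]
  rw [← this, Subsingleton.elim (e.comp (Ext.mk₀ r.i) (add_zero i)) 0, Ext.zero_comp]

lemma extVanishes_of_projective {P N : A} [Projective P] {i : ℕ} (hi : 0 < i) :
    ExtVanishes P N i := by
  let := HasExt.standard A
  obtain ⟨j, rfl⟩ := Nat.exists_eq_succ_of_ne_zero hi.ne'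
  exact Ext.subsingleton_of_projective P N j

end ExtVanishing

/-! ### Closure properties and approximations of a cluster tilting subcategory -/

namespace IsClusterTilting

variable {A : Type u} [Category.{v} A] [Abelian A] {n : ℕ} {M : ObjectProperty A}

lemma extVanishes (hM : IsClusterTilting n M) {N X : A} (hN : M N) (hX : M X) {i : ℕ}
    (h₀ : 0 < i) (hi : i < n) : ExtVanishes N X i := by
  rw [← hM.rightPerp_eq] at hX
  exact hX hN i h₀ hi

lemma prop_of_rightPerp (hM : IsClusterTilting n M) {X : A} (hX : rightPerp n M X) : M X := by
  rwa [hM.rightPerp_eq] at hX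

lemma prop_of_leftPerp (hM : IsClusterTilting n M) {X : A} (hX : leftPerp n M X) : M X := by
  rwa [hM.leftPerp_eq] at hX

lemma prop_of_retract (hM : IsClusterTilting n M) {X Y : A} (r : Retract X Y) (hY : M Y) :
    M X :=
  hM.prop_of_rightPerp fun _ hN _ h₀ hi => extVanishes_of_retract r (hM.extVanishes hN hY h₀ hi)

lemma prop_of_iso (hM : IsClusterTilting n M) {X Y : A} (e : X ≅ Y) (hY : M Y) : M X :=
  hM.prop_of_retract (Retract.ofIso e) hY

lemma prop_X₂ (hM : IsClusterTilting n M) {S : ShortComplex A} (hS : S.ShortExact)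
    (h₁ : M S.X₁) (h₃ : M S.X₃) : M S.X₂ :=
  hM.prop_of_rightPerp fun _ hN _ h₀ hi =>
    extVanishes_X₂ hS (hM.extVanishes hN h₁ h₀ hi) (hM.extVanishes hN h₃ h₀ hi)

lemma prop_biprod (hM : IsClusterTilting n M) {X Y : A} (hX : M X) (hY : M Y) : M (X ⊞ Y) :=
  hM.prop_X₂ (ShortComplex.Splitting.ofHasBinaryBiproduct X Y).shortExact hX hY

lemma prop_of_projective (hM : IsClusterTilting n M) (P : A) [Projective P] : M P :=
  hM.prop_of_leftPerp fun _ _ _ h₀ _ => extVanishes_of_projective h₀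

/-- Right approximations are epimorphisms; their kernels give proper short exact sequences. -/
lemma exists_right_approximation (hM : IsClusterTilting n M) (X : A) :
    ∃ S : ShortComplex A, IsProperShortExact M S ∧ M S.X₂ ∧ S.X₃ = X := by
  obtain ⟨N, π, hN, hπ⟩ := hM.functoriallyFinite.contravariantly_finite X
  obtain ⟨P, q, hP, hq⟩ := hM.generating X
  obtain ⟨h, rfl⟩ := hπ hP q
  have : Epi π := epi_of_epi h π
  exact ⟨ShortComplex.mk (kernel.ι π) π (kernel.condition π),
    ⟨{ exact := ShortComplex.exact_kernel π }, fun _ hN' x => hπ hN' x⟩, hN, rfl⟩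

lemma exists_left_approximation (hM : IsClusterTilting n M) (X : A) :
    ∃ S : ShortComplex A, S.ShortExact ∧
      (∀ ⦃N : A⦄, M N → ∀ x : S.X₁ ⟶ N, ∃ y : S.X₂ ⟶ N, S.f ≫ y = x) ∧ M S.X₂ ∧ S.X₁ = X := by
  obtain ⟨N, ι, hN, hι⟩ := hM.functoriallyFinite.covariantly_finite X
  obtain ⟨P, q, hP, hq⟩ := hM.cogenerating X
  obtain ⟨h, rfl⟩ := hι hP q
  have : Mono ι := mono_of_mono ι h
  exact ⟨ShortComplex.mk ι (cokernel.π ι) (cokernel.condition ι),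
    { exact := ShortComplex.exact_cokernel ι }, fun _ hN' x => hι hN' x, hN, rfl⟩

end IsClusterTilting

/-! ### Equivalences between quotient categories -/

section Quotients

/-- Two categories are equivalent when both are quotients of a third one by the same congruence. -/
lemma nonempty_equivalence_of_full_of_essSurj {S D E : Type*} [Category* S] [Category* D]
    [Category* E] (F : S ⥤ D) (G : S ⥤ E) [F.Full] [F.EssSurj] [G.Full] [G.EssSurj]
    (h : ∀ ⦃X Y : S⦄ (f g : X ⟶ Y), F.map f = F.map g ↔ G.map f = G.map g) :
    Nonempty (D ≌ E) := by
  have e : F.homRel = G.homRel := by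
    funext X Y f g
    exact propext (h f g)
  -- A full, essentially surjective functor is the quotient by its own kernel congruence, up to
  -- equivalence.
  have e₁ := (CategoryTheory.Quotient.lift F.homRel F (fun _ _ _ _ h => h)).asEquivalence
  have e₂ := (CategoryTheory.Quotient.lift G.homRel G (fun _ _ _ _ h => h)).asEquivalence
  rw [← e] at e₂
  exact ⟨e₁.symm.trans e₂⟩

variable {D : Type*} [Category* D] [Preadditive D] {K : ObjectProperty D}

/-- Every map from `X` to an object of `K` passes through `ι`, so the generators of the ideal
already form a subgroup and sums are harmless. -/
lemma mem_factorIdeal_iff_of_isLeftApproximation {X N Y : D} {ι : X ⟶ N}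
    (hι : IsLeftApproximation K ι) (f : X ⟶ Y) :
    f ∈ factorIdeal K X Y ↔ ∃ h : N ⟶ Y, ι ≫ h = f := by
  refine ⟨fun hf => ?_, fun ⟨h, hh⟩ => AddSubgroup.subset_closure ⟨N, ι, h, hι.1, hh⟩⟩
  induction hf using AddSubgroup.closure_induction with
  | mem x hx =>
    obtain ⟨Z, a, b, hZ, rfl⟩ := hx
    obtain ⟨c, rfl⟩ := hι.2 hZ a
    exact ⟨c ≫ b, by simp⟩
  | zero => exact ⟨0, by simp⟩
  | add x y _ _ hx hy =>
    obtain ⟨a, rfl⟩ := hx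
    obtain ⟨b, rfl⟩ := hy
    exact ⟨a + b, by simp⟩
  | neg x _ hx =>
    obtain ⟨a, rfl⟩ := hx
    exact ⟨-a, by simp⟩

lemma mem_factorIdeal_iff_of_isRightApproximation {X N Y : D} {π : N ⟶ Y}
    (hπ : IsRightApproximation K π) (f : X ⟶ Y) :
    f ∈ factorIdeal K X Y ↔ ∃ h : X ⟶ N, h ≫ π = f := by
  refine ⟨fun hf => ?_, fun ⟨h, hh⟩ => AddSubgroup.subset_closure ⟨N, h, π, hπ.1, hh⟩⟩
  induction hf using AddSubgroup.closure_induction with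
  | mem x hx =>
    obtain ⟨Z, a, b, hZ, rfl⟩ := hx
    obtain ⟨c, rfl⟩ := hπ.2 hZ b
    exact ⟨a ≫ c, by simp⟩
  | zero => exact ⟨0, by simp⟩
  | add x y _ _ hx hy =>
    obtain ⟨a, rfl⟩ := hx
    obtain ⟨b, rfl⟩ := hy
    exact ⟨a + b, by simp⟩
  | neg x _ hx =>
    obtain ⟨a, rfl⟩ := hx
    exact ⟨-a, by simp⟩

/-- An additive equivalence induces an equivalence of stable categories. -/
lemma nonempty_stableCategory_equivalence {E : Type*} [Category* E] [Preadditive E]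
    {L : ObjectProperty E} [L.IsClosedUnderIsomorphisms] (F : D ⥤ E) [F.Additive] [F.Full]
    [F.Faithful] [F.EssSurj] (h : ∀ X, K X ↔ L (F.obj X)) :
    Nonempty (StableCategory D K ≌ StableCategory E L) := by
  refine nonempty_equivalence_of_full_of_essSurj (Quotient.functor (factorRel K))
    (F ⋙ Quotient.functor (factorRel L)) fun X Y f g => ?_
  rw [Functor.comp_map, Functor.comp_map, Quotient.functor_map_eq_iff,
    Quotient.functor_map_eq_iff]
  change f - g ∈ _ ↔ F.map f - F.map g ∈ _
  rw [← F.map_sub]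
  generalize f - g = d
  constructor
  · intro hd
    induction hd using AddSubgroup.closure_induction with
    | mem x hx =>
      obtain ⟨Z, a, b, hZ, rfl⟩ := hx
      exact AddSubgroup.subset_closure ⟨F.obj Z, F.map a, F.map b, (h Z).1 hZ, by simp⟩
    | zero => simp [zero_mem]
    | add x y _ _ hx hy => rw [F.map_add]; exact add_mem hx hy
    | neg x _ hx => rw [F.map_neg]; exact neg_mem hx
  · intro hd
    -- The induction must run over an element of the target ideal, so the claim is stated for every
    -- preimage of it.
    obtain ⟨e, he⟩ : ∃ e, F.map d = e := ⟨_, rfl⟩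
    rw [he] at hd
    suffices ∀ d, F.map d = e → d ∈ factorIdeal K X Y from this d he
    clear he d f g
    induction hd using AddSubgroup.closure_induction with
    | mem x hx =>
      obtain ⟨Z, a, b, hZ, rfl⟩ := hx
      intro d hd
      let i := F.objObjPreimageIso Z
      refine AddSubgroup.subset_closure ⟨F.objPreimage Z, F.preimage (a ≫ i.inv),
        F.preimage (i.hom ≫ b), (h _).2 (L.prop_of_iso i.symm hZ), F.map_injective ?_⟩
      simp [hd]
    | zero =>
      intro d hd
      rw [F.map_injective (hd.trans (F.map_zero _ _).symm)]
      exact zero_mem _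
    | add x y _ _ hx hy =>
      intro d hd
      have : d = F.preimage x + F.preimage y := F.map_injective (by simp [hd, F.map_add])
      rw [this]
      exact add_mem (hx _ (by simp)) (hy _ (by simp))
    | neg x _ hx =>
      intro d hd
      have : d = -F.preimage x := F.map_injective (by simp [hd, F.map_neg])
      rw [this]
      exact neg_mem (hx _ (by simp))

end Quotients

/-! ### Factor categories of left and right terms of short exact sequences -/

section Shift

variable {A : Type u} [Category.{v} A]

section

variable [Preadditive A]

/-- The quotient of the full subcategory `P` by the morphisms that factor through `M`. -/
abbrev FactorCategory (M P : ObjectProperty A) :=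
  StableCategory P.FullSubcategory (fun X => M X.obj)

variable {M P : ObjectProperty A}

lemma mem_factorIdeal_fullSubcategory_iff_left (hMP : M ≤ P) {X Y : P.FullSubcategory} {N : A}
    {ι : X.obj ⟶ N} (hι : IsLeftApproximation M ι) (f : X ⟶ Y) :
    f ∈ factorIdeal (fun X : P.FullSubcategory => M X.obj) X Y ↔
      ∃ h : N ⟶ Y.obj, ι ≫ h = f.hom := by
  let ι' : X ⟶ ⟨N, hMP _ hι.1⟩ := ObjectProperty.homMk ι
  rw [mem_factorIdeal_iff_of_isLeftApproximation (ι := ι')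
    ⟨hι.1, fun N' hN' g => (hι.2 hN' g.hom).imp' ObjectProperty.homMk
      fun h hh => ObjectProperty.hom_ext _ hh⟩]
  exact ⟨fun ⟨h, hh⟩ => ⟨h.hom, by rw [← hh]; rfl⟩,
    fun ⟨h, hh⟩ => ⟨ObjectProperty.homMk h, ObjectProperty.hom_ext _ hh⟩⟩

lemma mem_factorIdeal_fullSubcategory_iff_right (hMP : M ≤ P) {X Y : P.FullSubcategory} {N : A}
    {π : N ⟶ Y.obj} (hπ : IsRightApproximation M π) (f : X ⟶ Y) :
    f ∈ factorIdeal (fun X : P.FullSubcategory => M X.obj) X Y ↔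
      ∃ h : X.obj ⟶ N, h ≫ π = f.hom := by
  let π' : (⟨N, hMP _ hπ.1⟩ : P.FullSubcategory) ⟶ Y := ObjectProperty.homMk π
  rw [mem_factorIdeal_iff_of_isRightApproximation (π := π')
    ⟨hπ.1, fun N' hN' g => (hπ.2 hN' g.hom).imp' ObjectProperty.homMk
      fun h hh => ObjectProperty.hom_ext _ hh⟩]
  exact ⟨fun ⟨h, hh⟩ => ⟨h.hom, by rw [← hh]; rfl⟩,
    fun ⟨h, hh⟩ => ⟨ObjectProperty.homMk h, ObjectProperty.hom_ext _ hh⟩⟩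

end

variable [Abelian A]

lemma _root_.CategoryTheory.ShortComplex.ShortExact.exists_lift {S : ShortComplex A}
    (hS : S.ShortExact) {Z : A} (k : Z ⟶ S.X₂) (hk : k ≫ S.g = 0) : ∃ l, l ≫ S.f = k := by
  have := hS.mono_f
  exact ⟨hS.exact.lift k hk, hS.exact.lift_f k hk⟩

lemma _root_.CategoryTheory.ShortComplex.ShortExact.exists_desc {S : ShortComplex A}
    (hS : S.ShortExact) {Z : A} (k : S.X₂ ⟶ Z) (hk : S.f ≫ k = 0) : ∃ l, S.g ≫ l = k := by
  have := hS.epi_g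
  exact ⟨hS.exact.desc k hk, hS.exact.g_desc k hk⟩

/-- For a morphism of short exact sequences, the left component extends to the middle term if and
only if the right component lifts to the middle term. -/
lemma exists_extension_τ₁_iff_exists_lift_τ₃ {S T : ShortComplex A} (hS : S.ShortExact)
    (hT : T.ShortExact) (d : S ⟶ T) :
    (∃ h : S.X₂ ⟶ T.X₁, S.f ≫ h = d.τ₁) ↔ ∃ k : S.X₃ ⟶ T.X₂, k ≫ T.g = d.τ₃ := by
  have := hS.epi_g
  have := hT.mono_f
  constructor
  · rintro ⟨h, hh⟩
    -- The extension `h` is one half of a homotopy; what remains of `d.τ₂` kills `S.f` and descends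
    -- to the other half.
    obtain ⟨k, hk⟩ := hS.exists_desc (d.τ₂ - h ≫ T.f) (by
      rw [Preadditive.comp_sub, ← d.comm₁₂, reassoc_of% hh, sub_self])
    refine ⟨k, (cancel_epi S.g).1 ?_⟩
    rw [reassoc_of% hk, Preadditive.sub_comp, d.comm₂₃, Category.assoc, T.zero, comp_zero,
      sub_zero]
  · rintro ⟨k, hk⟩
    obtain ⟨h, hh⟩ := hT.exists_lift (d.τ₂ - S.g ≫ k) (by
      rw [Preadditive.sub_comp, d.comm₂₃, Category.assoc, hk, sub_self])
    refine ⟨h, (cancel_mono T.f).1 ?_⟩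
    rw [Category.assoc, hh, Preadditive.comp_sub, S.zero_assoc, zero_comp, sub_zero, d.comm₁₂]

/-- The obstruction to extending `a ≫ T.f` along `S.f` lies in `Ext¹(S.X₃, T.X₂)`; the third
component is then induced on cokernels. -/
lemma exists_hom_τ₁_eq {S T : ShortComplex A} (hS : S.ShortExact)
    (h : ExtVanishes S.X₃ T.X₂ 1) (a : S.X₁ ⟶ T.X₁) : ∃ φ : S ⟶ T, φ.τ₁ = a := by
  obtain ⟨b, hb⟩ := exists_extension_of_extVanishes hS h (a ≫ T.f)
  obtain ⟨c, hc⟩ := hS.exists_desc (b ≫ T.g) (by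
    rw [reassoc_of% hb, T.zero, comp_zero])
  exact ⟨⟨a, b, c, hb.symm, hc.symm⟩, rfl⟩

lemma exists_hom_τ₃_eq {S T : ShortComplex A} (hT : T.ShortExact)
    (h : ExtVanishes S.X₂ T.X₁ 1) (c : S.X₃ ⟶ T.X₃) : ∃ φ : S ⟶ T, φ.τ₃ = c := by
  obtain ⟨b, hb⟩ := exists_lift_of_extVanishes hT h (S.g ≫ c)
  obtain ⟨a, ha⟩ := hT.exists_lift (S.f ≫ b) (by
    rw [Category.assoc, hb, S.zero_assoc, zero_comp])
  exact ⟨⟨a, b, c, ha, hb⟩, rfl⟩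

/-- Short exact sequences with terms in `P`, `M` and `Q`. -/
def shortExactWithTerms (P M Q : ObjectProperty A) : ObjectProperty (ShortComplex A) :=
  fun S => S.ShortExact ∧ P S.X₁ ∧ M S.X₂ ∧ Q S.X₃

variable {P M Q : ObjectProperty A}

variable (P M Q) in
/-- The left term of a short exact sequence, as an object of the factor category. -/
abbrev leftTerm : (shortExactWithTerms P M Q).FullSubcategory ⥤ FactorCategory M P :=
  P.lift ((shortExactWithTerms P M Q).ι ⋙ ShortComplex.π₁) (fun S => S.property.2.1) ⋙
    Quotient.functor _

variable (P M Q) in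
/-- The right term of a short exact sequence, as an object of the factor category. -/
abbrev rightTerm : (shortExactWithTerms P M Q).FullSubcategory ⥤ FactorCategory M Q :=
  Q.lift ((shortExactWithTerms P M Q).ι ⋙ ShortComplex.π₃) (fun S => S.property.2.2.2) ⋙
    Quotient.functor _

lemma full_leftTerm (hQ : ∀ ⦃Y N : A⦄, Q Y → M N → ExtVanishes Y N 1) :
    (leftTerm P M Q).Full := by
  refine @Functor.Full.comp _ _ _ _ _ _ _ _ ⟨fun {S T} a => ?_⟩ inferInstance
  obtain ⟨φ, hφ⟩ := exists_hom_τ₁_eq S.property.1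
    (hQ S.property.2.2.2 T.property.2.2.1) a.hom
  exact ⟨ObjectProperty.homMk φ, ObjectProperty.hom_ext _ hφ⟩

lemma full_rightTerm (hP : ∀ ⦃N X : A⦄, M N → P X → ExtVanishes N X 1) :
    (rightTerm P M Q).Full := by
  refine @Functor.Full.comp _ _ _ _ _ _ _ _ ⟨fun {S T} c => ?_⟩ inferInstance
  obtain ⟨φ, hφ⟩ := exists_hom_τ₃_eq T.property.1
    (hP S.property.2.2.1 T.property.2.1) c.hom
  exact ⟨ObjectProperty.homMk φ, ObjectProperty.hom_ext _ hφ⟩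

lemma essSurj_leftTerm (h : ∀ X, P X → ∃ S, shortExactWithTerms P M Q S ∧ S.X₁ = X) :
    (leftTerm P M Q).EssSurj := by
  refine @Functor.essSurj_comp _ _ _ _ _ _ _ _ ⟨fun X => ?_⟩ inferInstance
  obtain ⟨X, hX⟩ := X
  obtain ⟨S, hS, rfl⟩ := h X hX
  exact ⟨⟨S, hS⟩, ⟨Iso.refl _⟩⟩

lemma essSurj_rightTerm (h : ∀ X, Q X → ∃ S, shortExactWithTerms P M Q S ∧ S.X₃ = X) :
    (rightTerm P M Q).EssSurj := by
  refine @Functor.essSurj_comp _ _ _ _ _ _ _ _ ⟨fun X => ?_⟩ inferInstance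
  obtain ⟨X, hX⟩ := X
  obtain ⟨S, hS, rfl⟩ := h X hX
  exact ⟨⟨S, hS⟩, ⟨Iso.refl _⟩⟩

/-- Since `Ext¹(Q, M) = 0`, the map `S.f` is a left `M`-approximation, so it tests membership in the
ideal. -/
lemma leftTerm_map_eq_iff (hMP : M ≤ P) (hQ : ∀ ⦃Y N : A⦄, Q Y → M N → ExtVanishes Y N 1)
    {S T : (shortExactWithTerms P M Q).FullSubcategory} (f g : S ⟶ T) :
    (leftTerm P M Q).map f = (leftTerm P M Q).map g ↔
      ∃ h : S.obj.X₂ ⟶ T.obj.X₁, S.obj.f ≫ h = (f.hom - g.hom).τ₁ := by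
  refine (Quotient.functor_map_eq_iff _ _ _).trans ?_
  exact mem_factorIdeal_fullSubcategory_iff_left hMP (X := ⟨S.obj.X₁, S.property.2.1⟩)
    (Y := ⟨T.obj.X₁, T.property.2.1⟩) (ι := S.obj.f) ⟨S.property.2.2.1, fun N hN x =>
      exists_extension_of_extVanishes S.property.1 (hQ S.property.2.2.2 hN) x⟩
    (ObjectProperty.homMk f.hom.τ₁ - ObjectProperty.homMk g.hom.τ₁)

lemma rightTerm_map_eq_iff (hMQ : M ≤ Q) (hP : ∀ ⦃N X : A⦄, M N → P X → ExtVanishes N X 1)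
    {S T : (shortExactWithTerms P M Q).FullSubcategory} (f g : S ⟶ T) :
    (rightTerm P M Q).map f = (rightTerm P M Q).map g ↔
      ∃ h : S.obj.X₃ ⟶ T.obj.X₂, h ≫ T.obj.g = (f.hom - g.hom).τ₃ := by
  refine (Quotient.functor_map_eq_iff _ _ _).trans ?_
  exact mem_factorIdeal_fullSubcategory_iff_right hMQ (X := ⟨S.obj.X₃, S.property.2.2.2⟩)
    (Y := ⟨T.obj.X₃, T.property.2.2.2⟩) (π := T.obj.g) ⟨T.property.2.2.1, fun N hN x =>
      exists_lift_of_extVanishes T.property.1 (hP hN T.property.2.1) x⟩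
    (ObjectProperty.homMk f.hom.τ₃ - ObjectProperty.homMk g.hom.τ₃)

/-- The Ext conditions make both end-term functors full, and by the homotopy criterion
`exists_extension_τ₁_iff_exists_lift_τ₃` they have the same kernel congruence. -/
lemma nonempty_factorCategory_equivalence (hMP : M ≤ P) (hMQ : M ≤ Q)
    (hP : ∀ ⦃N X : A⦄, M N → P X → ExtVanishes N X 1)
    (hQ : ∀ ⦃Y N : A⦄, Q Y → M N → ExtVanishes Y N 1)
    (hP' : ∀ X, P X → ∃ S, shortExactWithTerms P M Q S ∧ S.X₁ = X)
    (hQ' : ∀ X, Q X → ∃ S, shortExactWithTerms P M Q S ∧ S.X₃ = X) :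
    Nonempty (FactorCategory M P ≌ FactorCategory M Q) := by
  have := full_leftTerm (P := P) hQ
  have := full_rightTerm (Q := Q) hP
  have := essSurj_leftTerm hP'
  have := essSurj_rightTerm hQ'
  refine nonempty_equivalence_of_full_of_essSurj (leftTerm P M Q) (rightTerm P M Q)
    fun S T f g => ?_
  rw [leftTerm_map_eq_iff hMP hQ, rightTerm_map_eq_iff hMQ hP,
    exists_extension_τ₁_iff_exists_lift_τ₃ S.property.1 T.property.1]

end Shift

/-! ### Trading right orthogonality for left orthogonality by cosyzygies -/

section Syzygies

variable {A : Type u} [Category.{v} A] [Abelian A] {n : ℕ} {M : ObjectProperty A}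

lemma rightPerp_one : rightPerp 1 M = ⊤ := by
  ext X
  exact ⟨fun _ => trivial, fun _ _ _ _ _ _ => by omega⟩

lemma leftPerp_one : leftPerp 1 M = ⊤ := by
  ext X
  exact ⟨fun _ => trivial, fun _ _ _ _ _ _ => by omega⟩

namespace IsClusterTilting

lemma le_rightPerp (hM : IsClusterTilting n M) {m : ℕ} (hm : m ≤ n) : M ≤ rightPerp m M :=
  fun _ hX _ hN _ h₀ hi => hM.extVanishes hN hX h₀ (hi.trans_le hm)

lemma le_leftPerp (hM : IsClusterTilting n M) {m : ℕ} (hm : m ≤ n) : M ≤ leftPerp m M :=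
  fun _ hX _ hN _ h₀ hi => hM.extVanishes hX hN h₀ (hi.trans_le hm)

/-- Dimension shift gains one degree of orthogonality; the new degree one comes from properness of
the sequence, not from `S.X₃`. -/
lemma rightPerp_X₁ (hM : IsClusterTilting n M) {S : ShortComplex A}
    (hS : IsProperShortExact M S) (h₂ : M S.X₂) {m : ℕ} (hm : m < n)
    (h₃ : rightPerp m M S.X₃) : rightPerp (m + 1) M S.X₁ := by
  intro N hN i h₀ hi
  obtain ⟨j, rfl⟩ := Nat.exists_eq_succ_of_ne_zero h₀.ne'
  obtain rfl | hj := Nat.eq_zero_or_pos j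
  · exact extVanishes_one_of_lift hS.1 (hM.extVanishes hN h₂ h₀ (by omega)) (hS.2 hN)
  · exact extVanishes_X₁ hS.1 (h₃ hN j hj (by omega)) (hM.extVanishes hN h₂ h₀ (by omega))

lemma rightPerp_X₃ (hM : IsClusterTilting n M) {S : ShortComplex A} (hS : S.ShortExact)
    (h₂ : M S.X₂) {m : ℕ} (hm : m ≤ n) (h₁ : rightPerp (m + 1) M S.X₁) :
    rightPerp m M S.X₃ := fun _ hN i h₀ hi =>
  extVanishes_X₃ hS (hM.extVanishes hN h₂ h₀ (hi.trans_le hm)) (h₁ hN _ (by omega) (by omega))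

lemma leftPerp_X₃ (hM : IsClusterTilting n M) {S : ShortComplex A} (hS : S.ShortExact)
    (hl : ∀ ⦃N : A⦄, M N → ∀ x : S.X₁ ⟶ N, ∃ y : S.X₂ ⟶ N, S.f ≫ y = x)
    (h₂ : M S.X₂) {m : ℕ} (hm : m < n) (h₁ : leftPerp m M S.X₁) : leftPerp (m + 1) M S.X₃ := by
  intro N hN i h₀ hi
  obtain ⟨j, rfl⟩ := Nat.exists_eq_succ_of_ne_zero h₀.ne'
  obtain rfl | hj := Nat.eq_zero_or_pos j
  · exact extVanishes_one_of_extension hS (hM.extVanishes h₂ hN h₀ (by omega)) (hl hN)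
  · exact extVanishes_X₃' hS (h₁ hN j hj (by omega)) (hM.extVanishes h₂ hN h₀ (by omega))

lemma leftPerp_X₁ (hM : IsClusterTilting n M) {S : ShortComplex A} (hS : S.ShortExact)
    (h₂ : M S.X₂) {m : ℕ} (hm : m ≤ n) (h₃ : leftPerp (m + 1) M S.X₃) :
    leftPerp m M S.X₁ := fun _ hN i h₀ hi =>
  extVanishes_X₁' hS (hM.extVanishes h₂ hN h₀ (hi.trans_le hm)) (h₃ hN _ (by omega) (by omega))

/-- The correspondence sends `X` to the cokernel of its left approximation, and back by kernels of
right approximations. Positivity of `m` and `j` supplies the `Ext¹` vanishing on the two sides. -/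
lemma nonempty_cosyzygy_equivalence (hM : IsClusterTilting n M) {m j : ℕ} (h : m + j < n)
    (hm : 0 < m) (hj : 0 < j) :
    Nonempty (FactorCategory M (rightPerp (m + 1) M ⊓ leftPerp j M) ≌
      FactorCategory M (rightPerp m M ⊓ leftPerp (j + 1) M)) := by
  refine nonempty_factorCategory_equivalence
    (fun X hX => ⟨hM.le_rightPerp (by omega) X hX, hM.le_leftPerp (by omega) X hX⟩)
    (fun X hX => ⟨hM.le_rightPerp (by omega) X hX, hM.le_leftPerp (by omega) X hX⟩)
    (fun N X hN hX => hX.1 hN 1 one_pos (by omega)) (fun Y N hY hN => hY.2 hN 1 one_pos (by omega))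
    (fun X hX => ?_) (fun X hX => ?_)
  · obtain ⟨S, hS, hl, h₂, rfl⟩ := hM.exists_left_approximation X
    exact ⟨S, ⟨hS, hX, h₂, hM.rightPerp_X₃ hS h₂ (by omega) hX.1,
      hM.leftPerp_X₃ hS hl h₂ (by omega) hX.2⟩, rfl⟩
  · obtain ⟨S, hS, h₂, rfl⟩ := hM.exists_right_approximation X
    exact ⟨S, ⟨hS.1, ⟨hM.rightPerp_X₁ hS h₂ (by omega) hX.1,
      hM.leftPerp_X₁ hS.1 h₂ (by omega) hX.2⟩, h₂, hX⟩, rfl⟩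

/-- Each cosyzygy lowers `m` and raises `j`, keeping `m + j`; at `m = 0` the right condition
`rightPerp 1 M` is empty. -/
lemma nonempty_rightPerp_inf_leftPerp_equivalence (hM : IsClusterTilting n M) (m : ℕ) :
    ∀ j, m + j + 1 < n → Nonempty (FactorCategory M (rightPerp (m + 1) M ⊓ leftPerp (j + 1) M) ≌
      FactorCategory M (leftPerp (m + j + 1) M)) := by
  induction m with
  | zero =>
    intro j _
    rw [rightPerp_one, top_inf_eq, Nat.zero_add]
    exact ⟨CategoryTheory.Equivalence.refl⟩
  | succ m ih =>
    intro j h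
    obtain ⟨e⟩ := ih (j + 1) (by omega)
    obtain ⟨e'⟩ := hM.nonempty_cosyzygy_equivalence (m := m + 1) (j := j + 1)
      (by omega) (by omega) (by omega)
    rw [show m + (j + 1) + 1 = m + 1 + j + 1 by omega] at e
    exact ⟨e'.trans e⟩

lemma nonempty_rightPerp_equivalence_leftPerp (hM : IsClusterTilting n M) (hn : 2 ≤ n) :
    Nonempty (FactorCategory M (rightPerp (n - 1) M) ≌ FactorCategory M (leftPerp (n - 1) M)) := by
  obtain ⟨m, rfl⟩ := Nat.exists_eq_add_of_le' hn
  have := hM.nonempty_rightPerp_inf_leftPerp_equivalence m 0 (by omega)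
  rwa [leftPerp_one, inf_top_eq] at this

end IsClusterTilting

end Syzygies

/-! ### Exactness in functor categories, tested pointwise -/

section Pointwise

lemma functor_exact_iff_evaluation {J C : Type*} [Category* J] [Category* C] [Abelian C]
    (S : ShortComplex (J ⥤ C)) :
    S.Exact ↔ ∀ j, (S.map ((evaluation J C).obj j)).Exact := by
  refine ⟨fun hS j => hS.map _, fun h => ?_⟩
  rw [ShortComplex.exact_iff_isZero_homology, Functor.isZero_iff]
  intro j
  exact ((ShortComplex.exact_iff_isZero_homology _).1 (h j)).of_iso
    (S.mapHomologyIso ((evaluation J C).obj j)).symm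

variable {J : Type*} [Category* J] {F G E : J ⥤ AddCommGrpCat.{w}}

lemma functor_exact_iff {φ : F ⟶ G} {ψ : G ⟶ E} (h : φ ≫ ψ = 0) :
    (ShortComplex.mk φ ψ h).Exact ↔
      ∀ j (x : G.obj j), ψ.app j x = 0 → ∃ y, φ.app j y = x := by
  rw [functor_exact_iff_evaluation]
  exact forall_congr' fun j => ShortComplex.ab_exact_iff _

lemma functor_epi_iff (φ : F ⟶ G) : Epi φ ↔ ∀ j, Function.Surjective (φ.app j) := by
  rw [NatTrans.epi_iff_epi_app]
  exact forall_congr' fun j => AddCommGrpCat.epi_iff_surjective _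

lemma functor_mono_iff (φ : F ⟶ G) : Mono φ ↔ ∀ j, Function.Injective (φ.app j) := by
  rw [NatTrans.mono_iff_mono_app]
  exact forall_congr' fun j => AddCommGrpCat.mono_iff_injective _

variable [Preadditive J] in
lemma additive_of_surjective [F.Additive] (φ : F ⟶ G) (h : ∀ j, Function.Surjective (φ.app j)) :
    G.Additive where
  map_add {X Y f g} := by
    ext x
    obtain ⟨x, rfl⟩ := h _ x
    simp only [← NatTrans.naturality_apply, F.map_add, AddCommGrpCat.hom_add,
      AddMonoidHom.add_apply, map_add]

end Pointwise

/-! ### The restricted Yoneda functor and presentations -/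

section RestrictedYoneda

variable {A : Type u} [Category.{v} A] [Preadditive A] (M : ObjectProperty A)

/-- The functor `X ↦ Hom(-, X)` from `A` to the right modules over the full subcategory `M`. -/
def restrictedYoneda : A ⥤ M.FullSubcategoryᵒᵖ ⥤ AddCommGrpCat.{v} where
  obj X :=
    { obj := fun N => AddCommGrpCat.of (N.unop.obj ⟶ X)
      map := fun u => AddCommGrpCat.ofHom
        (AddMonoidHom.mk' (fun x => u.unop.hom ≫ x) fun _ _ => Preadditive.comp_add _ _ _ _ _ _)
      map_id := fun N => by ext x; exact Category.id_comp x
      map_comp := fun u u' => by ext x; exact Category.assoc u'.unop.hom u.unop.hom x }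
  map f :=
    { app := fun N => AddCommGrpCat.ofHom
        (AddMonoidHom.mk' (fun x => x ≫ f) fun _ _ => Preadditive.add_comp _ _ _ _ _ _)
      naturality := fun _ _ u => by ext x; exact Category.assoc u.unop.hom x f }
  map_id X := by ext N x; exact Category.comp_id x
  map_comp f g := by ext N x; exact (Category.assoc x f g).symm

variable {M}

instance : (restrictedYoneda M).Additive where
  map_add {X Y f g} := by
    ext N x
    exact Preadditive.comp_add _ _ _ x f g

instance (X : A) : ((restrictedYoneda M).obj X).Additive where
  map_add {N N' f g} := by
    ext x
    exact Preadditive.add_comp _ _ _ f.unop.hom g.unop.hom x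

/-- On `M`, the restricted Yoneda functor is the Yoneda embedding. -/
def yonedaIsoRestrictedYoneda (X : M.FullSubcategory) :
    preadditiveYoneda.obj X ≅ (restrictedYoneda M).obj X.obj :=
  NatIso.ofComponents (fun N => AddEquiv.toAddCommGrpIso
    (X := AddCommGrpCat.of (N.unop ⟶ X)) (Y := AddCommGrpCat.of (N.unop.obj ⟶ X.obj))
    { toFun := fun f => f.hom
      invFun := fun f => ObjectProperty.homMk f
      left_inv := fun _ => rfl
      right_inv := fun _ => rfl
      map_add' := fun _ _ => rfl }) fun u => by
    ext x
    rfl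

variable {F : M.FullSubcategoryᵒᵖ ⥤ AddCommGrpCat.{v}}

lemma restrictedYoneda_hom_apply (N : M.FullSubcategory)
    (t : (restrictedYoneda M).obj N.obj ⟶ F) {N' : M.FullSubcategory} (u : N' ⟶ N) :
    t.app (op N') u.hom = F.map u.op (t.app (op N) (𝟙 N.obj)) :=
  (congrArg (t.app (op N')) (Category.comp_id u.hom).symm).trans
    (NatTrans.naturality_apply t u.op (𝟙 N.obj))

lemma restrictedYoneda_hom_ext (N : M.FullSubcategory)
    {t t' : (restrictedYoneda M).obj N.obj ⟶ F}
    (h : t.app (op N) (𝟙 N.obj) = t'.app (op N) (𝟙 N.obj)) : t = t' := by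
  ext N' x
  exact (restrictedYoneda_hom_apply N t (ObjectProperty.homMk x)).trans
    ((congrArg _ h).trans (restrictedYoneda_hom_apply N t' (ObjectProperty.homMk x)).symm)

/-- The surjective half of Yoneda's lemma; additivity of `F` makes the components group
homomorphisms. -/
lemma exists_restrictedYoneda_hom [F.Additive] (N : M.FullSubcategory) (x : F.obj (op N)) :
    ∃ t : (restrictedYoneda M).obj N.obj ⟶ F, t.app (op N) (𝟙 N.obj) = x := by
  refine ⟨{ app := fun N' => AddCommGrpCat.ofHom (AddMonoidHom.mk' (fun u : N'.unop.obj ⟶ N.obj =>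
    F.map (ObjectProperty.homMk u : N'.unop ⟶ N).op x) fun u u' => ?_),
            naturality := fun N' N'' u => ?_ }, ?_⟩
  · have : (ObjectProperty.homMk (u + u') : N'.unop ⟶ N).op =
      (ObjectProperty.homMk u : N'.unop ⟶ N).op + (ObjectProperty.homMk u' : N'.unop ⟶ N).op := rfl
    rw [this, F.map_add]
    rfl
  · ext y
    have : (ObjectProperty.homMk (u.unop.hom ≫ y) : N''.unop ⟶ N).op =
      (ObjectProperty.homMk y : N'.unop ⟶ N).op ≫ u := rfl
    change F.map (ObjectProperty.homMk (u.unop.hom ≫ y) : N''.unop ⟶ N).op x =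
      F.map u (F.map (ObjectProperty.homMk y : N'.unop ⟶ N).op x)
    rw [this, F.map_comp]
    rfl
  · change F.map (𝟙 (op N)) x = x
    rw [F.map_id]
    rfl

lemma exists_restrictedYoneda_lift {G : M.FullSubcategoryᵒᵖ ⥤ AddCommGrpCat.{v}} [G.Additive]
    {p : G ⟶ F} (hp : ∀ N, Function.Surjective (p.app N)) (N : M.FullSubcategory)
    (t : (restrictedYoneda M).obj N.obj ⟶ F) :
    ∃ s : (restrictedYoneda M).obj N.obj ⟶ G, s ≫ p = t := by
  obtain ⟨x, hx⟩ := hp _ (t.app (op N) (𝟙 N.obj))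
  obtain ⟨s, rfl⟩ := exists_restrictedYoneda_hom N x
  exact ⟨s, restrictedYoneda_hom_ext N hx⟩

/-- Pointwise exactness of `Hom(-, N₁) ⟶ Hom(-, N₀) ⟶ F ⟶ 0` on `M`. -/
structure IsPresentation {N₁ N₀ : A} (f : N₁ ⟶ N₀) (p : (restrictedYoneda M).obj N₀ ⟶ F) :
    Prop where
  surjective : ∀ N, Function.Surjective (p.app N)
  map_comp_eq_zero : (restrictedYoneda M).map f ≫ p = 0
  exists_factor : ∀ (N : M.FullSubcategory) (x : N.obj ⟶ N₀), p.app (op N) x = 0 →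
    ∃ y : N.obj ⟶ N₁, y ≫ f = x

lemma yonedaIsoRestrictedYoneda_naturality {X Y : M.FullSubcategory} (f : X ⟶ Y) :
    preadditiveYoneda.map f ≫ (yonedaIsoRestrictedYoneda Y).hom =
      (yonedaIsoRestrictedYoneda X).hom ≫ (restrictedYoneda M).map f.hom := by
  ext N x
  rfl

/-- Replaces exactness in the functor category by element-level conditions on maps of `A`, the form
in which all later diagram chases are done. -/
lemma isFinitelyPresented_iff :
    isFinitelyPresented M.FullSubcategory F ↔ F.Additive ∧ ∃ (N₁ N₀ : A) (f : N₁ ⟶ N₀)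
      (p : (restrictedYoneda M).obj N₀ ⟶ F), M N₁ ∧ M N₀ ∧ IsPresentation f p := by
  refine and_congr_right fun _ => ⟨?_, ?_⟩
  · rintro ⟨X, Y, φ, p, hp, h, h'⟩
    obtain ⟨f, rfl⟩ := preadditiveYoneda.map_surjective φ
    rw [functor_exact_iff] at h
    have h'' : Epi ((yonedaIsoRestrictedYoneda Y).inv ≫ p) := epi_comp _ _
    refine ⟨X.obj, Y.obj, f.hom, (yonedaIsoRestrictedYoneda Y).inv ≫ p, X.property, Y.property,
      (functor_epi_iff _).1 h'', ?_, fun N x hx => ?_⟩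
    · rw [← cancel_epi (yonedaIsoRestrictedYoneda X).hom, comp_zero,
        ← reassoc_of% yonedaIsoRestrictedYoneda_naturality f, Iso.hom_inv_id_assoc, hp]
    · obtain ⟨y, hy⟩ := h (op N) (ObjectProperty.homMk x : N ⟶ Y) hx
      exact ⟨InducedCategory.Hom.hom (show N ⟶ X from y), congrArg InducedCategory.Hom.hom hy⟩
  · rintro ⟨N₁, N₀, f, p, h₁, h₀, hs, hz, hf⟩
    have : Epi p := (functor_epi_iff p).2 hs
    refine ⟨⟨N₁, h₁⟩, ⟨N₀, h₀⟩, preadditiveYoneda.map (ObjectProperty.homMk f),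
      (yonedaIsoRestrictedYoneda ⟨N₀, h₀⟩).hom ≫ p, ?_, ?_, epi_comp _ _⟩
    · rw [reassoc_of% yonedaIsoRestrictedYoneda_naturality]
      exact (congrArg _ hz).trans comp_zero
    · rw [functor_exact_iff]
      intro N x hx
      obtain ⟨y, hy⟩ := hf N.unop (InducedCategory.Hom.hom (show N.unop ⟶ ⟨N₀, h₀⟩ from x)) hx
      exact ⟨(ObjectProperty.homMk y : N.unop ⟶ ⟨N₁, h₁⟩), ObjectProperty.hom_ext _ hy⟩

namespace IsPresentation

variable {N₁ N₀ : A} {f : N₁ ⟶ N₀} {p : (restrictedYoneda M).obj N₀ ⟶ F}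

lemma epi (h : IsPresentation f p) : Epi p := (functor_epi_iff p).2 h.surjective

lemma additive (h : IsPresentation f p) : F.Additive := additive_of_surjective p h.surjective

lemma app_comp (h : IsPresentation f p) {N : M.FullSubcategory} (x : N.obj ⟶ N₁) :
    p.app (op N) (x ≫ f) = 0 :=
  congrArg (fun t : (restrictedYoneda M).obj N₁ ⟶ F => t.app (op N) x) h.map_comp_eq_zero

lemma isFinitelyPresented (h : IsPresentation f p) (h₁ : M N₁) (h₀ : M N₀) :
    ClusterTilting.isFinitelyPresented M.FullSubcategory F :=
  isFinitelyPresented_iff.2 ⟨h.additive, N₁, N₀, f, p, h₁, h₀, h⟩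

lemma exact (h : IsPresentation f p) : (ShortComplex.mk _ p h.map_comp_eq_zero).Exact := by
  rw [functor_exact_iff]
  exact fun N x hx => h.exists_factor N.unop x hx

lemma exists_desc (h : IsPresentation f p) {G : M.FullSubcategoryᵒᵖ ⥤ AddCommGrpCat.{v}}
    (t : (restrictedYoneda M).obj N₀ ⟶ G) (ht : (restrictedYoneda M).map f ≫ t = 0) :
    ∃ s : F ⟶ G, p ≫ s = t := by
  have := h.epi
  exact ⟨h.exact.desc t ht, h.exact.g_desc t ht⟩

/-- The functor with a given presentation is unique up to isomorphism. -/
lemma nonempty_iso (h : IsPresentation f p) {G : M.FullSubcategoryᵒᵖ ⥤ AddCommGrpCat.{v}}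
    {q : (restrictedYoneda M).obj N₀ ⟶ G} (h' : IsPresentation f q) : Nonempty (F ≅ G) := by
  have := h.epi
  have := h'.epi
  obtain ⟨s, hs⟩ := h.exists_desc q h'.map_comp_eq_zero
  obtain ⟨t, ht⟩ := h'.exists_desc p h.map_comp_eq_zero
  exact ⟨⟨s, t, by rw [← cancel_epi p, reassoc_of% hs, ht, Category.comp_id],
    by rw [← cancel_epi q, reassoc_of% ht, hs, Category.comp_id]⟩⟩

end IsPresentation

lemma isPresentation_cokernel {N₁ N₀ : A} (f : N₁ ⟶ N₀) :
    IsPresentation f (cokernel.π ((restrictedYoneda M).map f)) where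
  surjective := (functor_epi_iff _).1 inferInstance
  map_comp_eq_zero := cokernel.condition _
  exists_factor N x hx := (functor_exact_iff (cokernel.condition _)).1
    (ShortComplex.exact_cokernel ((restrictedYoneda M).map f)) (op N) x hx

end RestrictedYoneda

/-! ### Projectives of mod-`M` and functors of projective dimension at most one -/

section Projective

variable {A : Type u} [Category.{v} A] [Abelian A] {n : ℕ} {M : ObjectProperty A}

lemma isPresentation_of_isProperShortExact {S : ShortComplex A} (hS : IsProperShortExact M S) :
    IsPresentation (M := M) S.f ((restrictedYoneda M).map S.g) where
  surjective N x := hS.2 N.unop.property x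
  map_comp_eq_zero := by rw [← Functor.map_comp, S.zero, Functor.map_zero]
  exists_factor N x hx := hS.1.exists_lift x hx

lemma isPresentation_id (N : A) :
    IsPresentation (M := M) (0 : N ⟶ N) (𝟙 ((restrictedYoneda M).obj N)) where
  surjective _ x := ⟨x, rfl⟩
  map_comp_eq_zero := by rw [Functor.map_zero, zero_comp]
  exists_factor _ x hx := ⟨0, zero_comp.trans (show x = 0 from hx).symm⟩

lemma isFinitelyPresented_restrictedYoneda {N : A} (hN : M N) :
    isFinitelyPresented M.FullSubcategory ((restrictedYoneda M).obj N) :=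
  (isPresentation_id N).isFinitelyPresented hN hN

lemma exists_restrictedYoneda_map_eq {N Y : A} (hN : M N)
    (t : (restrictedYoneda M).obj N ⟶ (restrictedYoneda M).obj Y) :
    ∃ f : N ⟶ Y, (restrictedYoneda M).map f = t :=
  ⟨t.app (op ⟨N, hN⟩) (𝟙 N), restrictedYoneda_hom_ext ⟨N, hN⟩ (Category.id_comp _)⟩

namespace IsClusterTilting

/-- Lift `e` to the generators as `a : Y ⟶ Y'`. The cokernel is generated by `Y'`, with relations
those of `G` together with the image of `a`; hence the presentation `biprod.desc f a`. -/
lemma isFinitelyPresented_cokernel (hM : IsClusterTilting n M)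
    {F G : M.FullSubcategoryᵒᵖ ⥤ AddCommGrpCat.{v}}
    (hF : isFinitelyPresented M.FullSubcategory F) (hG : isFinitelyPresented M.FullSubcategory G)
    (e : F ⟶ G) : isFinitelyPresented M.FullSubcategory (cokernel e) := by
  rw [isFinitelyPresented_iff] at hF hG
  obtain ⟨_, _, Y, _, p, _, hY, hp⟩ := hF
  obtain ⟨_, X', Y', f, q, hX', hY', hq⟩ := hG
  obtain ⟨a, ha⟩ := exists_restrictedYoneda_lift hq.surjective ⟨Y, hY⟩ (p ≫ e)
  obtain ⟨a, rfl⟩ := exists_restrictedYoneda_map_eq hY a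
  have hπ := (functor_epi_iff (cokernel.π e)).1 inferInstance
  have h : IsPresentation (biprod.desc f a) (q ≫ cokernel.π e) :=
    { surjective := fun N => (hπ N).comp (hq.surjective N)
      map_comp_eq_zero := by
        rw [biprod.desc_eq, Functor.map_add, Functor.map_comp, Functor.map_comp,
          Preadditive.add_comp, Category.assoc, Category.assoc, reassoc_of% hq.map_comp_eq_zero,
          reassoc_of% ha, cokernel.condition, zero_comp, comp_zero, comp_zero, comp_zero, add_zero]
      exists_factor := fun N x hx => by
        obtain ⟨w, hw⟩ := (functor_exact_iff (cokernel.condition e)).1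
          (ShortComplex.exact_cokernel e) (op N) (q.app (op N) x) hx
        obtain ⟨(y : N.obj ⟶ Y), rfl⟩ := hp.surjective _ w
        have hy : q.app (op N) (y ≫ a) = q.app (op N) x :=
          (congrArg (fun t : (restrictedYoneda M).obj Y ⟶ G => t.app (op N) y) ha).trans hw
        obtain ⟨u, hu⟩ := hq.exists_factor N (x - y ≫ a)
          ((map_sub (q.app (op N)).hom x _).trans (sub_eq_zero.2 hy.symm))
        exact ⟨biprod.lift u y, by rw [biprod.lift_desc, hu, sub_add_cancel]⟩ }
  exact h.isFinitelyPresented (hM.prop_biprod hX' hY) hY'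

/-- The cokernel in the full functor category is again finitely presented, so an epimorphism of
mod-`M` must kill it. Thus projectivity in mod-`M` can be tested on pointwise surjections. -/
lemma surjective_of_epi (hM : IsClusterTilting n M) {F G : FPMod M.FullSubcategory} (e : F ⟶ G)
    [Epi e] (N : M.FullSubcategoryᵒᵖ) : Function.Surjective (e.hom.app N) := by
  let c : G ⟶ ⟨_, hM.isFinitelyPresented_cokernel F.property G.property e.hom⟩ :=
    ObjectProperty.homMk (cokernel.π e.hom)
  have hc : c = 0 := by
    rw [← cancel_epi e, comp_zero]
    exact ObjectProperty.hom_ext _ (cokernel.condition e.hom)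
  have : Epi e.hom := Abelian.epi_of_cokernel_π_eq_zero _ (congrArg InducedCategory.Hom.hom hc)
  exact (functor_epi_iff e.hom).1 this N

lemma projective_restrictedYoneda (hM : IsClusterTilting n M) {F : FPMod M.FullSubcategory}
    {N : A} (hN : M N) (i : F.obj ≅ (restrictedYoneda M).obj N) : Projective F where
  factors {E X} f e _ := by
    have := E.property.1
    obtain ⟨s, hs⟩ := exists_restrictedYoneda_lift (hM.surjective_of_epi e) ⟨N, hN⟩
      (i.inv ≫ f.hom)
    refine ⟨ObjectProperty.homMk (i.hom ≫ s), ObjectProperty.hom_ext _ ?_⟩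
    change (i.hom ≫ s) ≫ e.hom = f.hom
    rw [Category.assoc, hs, i.hom_inv_id_assoc]

lemma exists_iso_of_projective (hM : IsClusterTilting n M) (P : FPMod M.FullSubcategory)
    [Projective P] : ∃ N, M N ∧ Nonempty ((restrictedYoneda M).obj N ≅ P.obj) := by
  obtain ⟨_, _, Y, _, p, _, hY, hp⟩ := isFinitelyPresented_iff.1 P.property
  let p' : (⟨_, isFinitelyPresented_restrictedYoneda hY⟩ : FPMod M.FullSubcategory) ⟶ P :=
    ObjectProperty.homMk p
  have := hp.epi
  have : Epi p' := (isFinitelyPresented M.FullSubcategory).ι.epi_of_epi_map (f := p') hp.epi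
  obtain ⟨s, hs⟩ : ∃ s : P.obj ⟶ (restrictedYoneda M).obj Y, s ≫ p = 𝟙 _ :=
    ⟨(Projective.factorThru (𝟙 P) p').hom,
      congrArg InducedCategory.Hom.hom (Projective.factorThru_comp (𝟙 P) p')⟩
  obtain ⟨ε, hε⟩ := exists_restrictedYoneda_map_eq hY (p ≫ s)
  have hY' : ∀ {a b : Y ⟶ Y}, (restrictedYoneda M).map a = (restrictedYoneda M).map b → a = b := by
    intro a b h
    have := congrArg (fun t : (restrictedYoneda M).obj Y ⟶ (restrictedYoneda M).obj Y =>
      t.app (op ⟨Y, hY⟩) (𝟙 Y)) h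
    exact (Category.id_comp a).symm.trans (this.trans (Category.id_comp b))
  -- The summand `P` of `Hom(-, Y)` is cut out by an idempotent of `Y`, which splits in `A`; `M` is
  -- closed under retracts.
  obtain ⟨N, i, r, hir, hri⟩ := IsIdempotentComplete.idempotents_split Y ε (hY' (by
    rw [Functor.map_comp, hε, Category.assoc, reassoc_of% hs]))
  refine ⟨N, hM.prop_of_retract ⟨i, r, hir⟩ hY, ⟨⟨(restrictedYoneda M).map i ≫ p,
    s ≫ (restrictedYoneda M).map r, ?_, ?_⟩⟩⟩
  · rw [Category.assoc, ← Category.assoc p, ← hε, ← Functor.map_comp, ← Functor.map_comp, ← hri,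
      Category.assoc, hir, Category.comp_id, hir, CategoryTheory.Functor.map_id]
  · rw [Category.assoc, ← Functor.map_comp_assoc, hri, hε, Category.assoc, hs, Category.comp_id,
      hs]

lemma faithful_restrictedYoneda (hM : IsClusterTilting n M) : (restrictedYoneda M).Faithful where
  map_injective {X Y f g} h := by
    obtain ⟨N, π, hN, _⟩ := hM.generating X
    rw [← cancel_epi π]
    exact congrArg (fun t : (restrictedYoneda M).obj X ⟶ (restrictedYoneda M).obj Y =>
      t.app (op ⟨N, hN⟩) π) h

/-- On a right approximation of `X` the transformation comes from a map by Yoneda; faithfulness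
shows that this map kills the kernel, so it descends to `X`. -/
lemma full_restrictedYoneda (hM : IsClusterTilting n M) : (restrictedYoneda M).Full where
  map_surjective {X Y} t := by
    have := hM.faithful_restrictedYoneda
    obtain ⟨S, hS, h₂, rfl⟩ := hM.exists_right_approximation X
    obtain ⟨b, hb⟩ := exists_restrictedYoneda_map_eq h₂ ((restrictedYoneda M).map S.g ≫ t)
    obtain ⟨c, hc⟩ := hS.1.exists_desc b ((restrictedYoneda M).map_injective (by
      rw [Functor.map_comp, hb, ← Functor.map_comp_assoc, S.zero, Functor.map_zero, zero_comp,
        Functor.map_zero]))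
    have := (isPresentation_of_isProperShortExact hS).epi
    exact ⟨c, by rw [← cancel_epi ((restrictedYoneda M).map S.g), ← Functor.map_comp, hc, hb]⟩

lemma projective_iff (hM : IsClusterTilting n M) {F : FPMod M.FullSubcategory} {X : A}
    (i : F.obj ≅ (restrictedYoneda M).obj X) : Projective F ↔ M X := by
  refine ⟨fun _ => ?_, fun hX => hM.projective_restrictedYoneda hX i⟩
  have := hM.faithful_restrictedYoneda
  have := hM.full_restrictedYoneda
  obtain ⟨N, hN, ⟨e⟩⟩ := hM.exists_iso_of_projective F
  exact hM.prop_of_iso ((restrictedYoneda M).preimageIso (i.symm ≪≫ e.symm)) hN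

lemma isProperShortExact (hM : IsClusterTilting n M) (hn : 2 ≤ n) {S : ShortComplex A}
    (hS : S.ShortExact) (h₁ : M S.X₁) : IsProperShortExact M S :=
  ⟨hS, fun _ hN x => exists_lift_of_extVanishes hS (hM.extVanishes hN h₁ one_pos hn) x⟩

lemma rightPerp_eq_properDimLEOne (hM : IsClusterTilting n M) (hn : 2 ≤ n) :
    rightPerp (n - 1) M = properDimLEOne M := by
  obtain ⟨m, rfl⟩ := Nat.exists_eq_add_of_le' hn
  ext X
  constructor
  · intro hX
    obtain ⟨S, hS, h₂, rfl⟩ := hM.exists_right_approximation X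
    exact ⟨S.X₁, S.X₂, S.f, S.g, S.zero,
      -- The kernel gains one degree and so reaches `rightPerp n M`, which is `M`.
      hM.prop_of_rightPerp (hM.rightPerp_X₁ hS h₂ (by omega) hX), h₂, hS⟩
  · rintro ⟨M₁, M₀, i, p, hp, h₁, h₀, hS⟩
    exact hM.rightPerp_X₃ hS.1 h₀ (by omega) (hM.le_rightPerp le_rfl _ h₁)

lemma le_properDimLEOne (hM : IsClusterTilting n M) (hn : 2 ≤ n) : M ≤ properDimLEOne M := by
  rw [← hM.rightPerp_eq_properDimLEOne hn]
  exact hM.le_rightPerp (by omega)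

/-- A projective resolution comes from a map `f` between objects of `M`, mono because a faithful
functor reflects monomorphisms. The sequence ending in its cokernel is automatically proper, as
`Ext¹(M, N₁) = 0`, so the cokernel represents the functor. -/
lemma projDimLEOne_iff (hM : IsClusterTilting n M) (hn : 2 ≤ n) (F : FPMod M.FullSubcategory) :
    projDimLEOne F ↔ ∃ X, properDimLEOne M X ∧ Nonempty ((restrictedYoneda M).obj X ≅ F.obj) := by
  have := hM.faithful_restrictedYoneda
  constructor
  · rintro ⟨P₁, P₀, i, p, hp, _, _, hS⟩
    obtain ⟨N₁, h₁, ⟨e₁⟩⟩ := hM.exists_iso_of_projective P₁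
    obtain ⟨N₀, h₀, ⟨e₀⟩⟩ := hM.exists_iso_of_projective P₀
    obtain ⟨f, hf⟩ := exists_restrictedYoneda_map_eq h₁ (e₁.hom ≫ i ≫ e₀.inv)
    have : Mono i := hS.mono_f
    have : Mono ((restrictedYoneda M).map f) := by
      rw [hf]
      infer_instance
    have : Mono f := (restrictedYoneda M).mono_of_mono_map this
    let S := ShortComplex.mk f (cokernel.π f) (cokernel.condition f)
    have hS' : IsProperShortExact M S :=
      hM.isProperShortExact hn { exact := ShortComplex.exact_cokernel f } h₁
    refine ⟨_, ⟨_, _, _, _, _, h₁, h₀, hS'⟩, ?_⟩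
    refine (isPresentation_of_isProperShortExact hS').nonempty_iso (q := e₀.hom ≫ p)
      ⟨?_, ?_, ?_⟩
    · exact (functor_epi_iff _).1 (epi_comp' inferInstance hS.epi_g)
    · change (restrictedYoneda M).map f ≫ e₀.hom ≫ p = 0
      rw [hf, Category.assoc, Category.assoc, e₀.inv_hom_id_assoc, hp, comp_zero]
    · intro N x hx
      obtain ⟨y, hy⟩ := (functor_exact_iff hp).1 hS.exact (op N) (e₀.hom.app (op N) x) hx
      refine ⟨e₁.inv.app (op N) y, ?_⟩
      have h : e₁.inv ≫ (restrictedYoneda M).map f = i ≫ e₀.inv := by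
        rw [hf, e₁.inv_hom_id_assoc]
      refine (congrArg (fun t : P₁.obj ⟶ (restrictedYoneda M).obj N₀ => t.app (op N) y) h).trans ?_
      refine (congrArg (e₀.inv.app (op N)) hy).trans ?_
      exact congrArg (fun t : (restrictedYoneda M).obj N₀ ⟶ (restrictedYoneda M).obj N₀ =>
        t.app (op N) x) e₀.hom_inv_id
  · rintro ⟨X, ⟨M₁, M₀, i, p, hp, h₁, h₀, hS⟩, ⟨e⟩⟩
    have hS' := isPresentation_of_isProperShortExact hS
    have : Mono i := hS.1.mono_f
    refine ⟨⟨_, isFinitelyPresented_restrictedYoneda h₁⟩,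
      ⟨_, isFinitelyPresented_restrictedYoneda h₀⟩, (restrictedYoneda M).map i,
      (restrictedYoneda M).map p ≫ e.hom, ?_,
      hM.projective_restrictedYoneda h₁ (Iso.refl _),
      hM.projective_restrictedYoneda h₀ (Iso.refl _), ?_⟩
    · rw [← Functor.map_comp_assoc, hp, Functor.map_zero, zero_comp]
    · refine ShortComplex.shortExact_of_iso (S₁ := (ShortComplex.mk _ _ hS'.map_comp_eq_zero))
        (ShortComplex.isoMk (Iso.refl _) (Iso.refl _) e (by simp) (by simp))
        { exact := hS'.exact
          mono_f := (functor_mono_iff _).2 fun N x y h => (cancel_mono i).1 h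
          epi_g := hS'.epi }

end IsClusterTilting

end Projective

/-! ### Relative projectives and the relative stable categories -/

section ProperDimension

variable {A : Type u} [Category.{v} A] [Abelian A] {n : ℕ} {M : ObjectProperty A}

namespace IsClusterTilting

/-- The length-one resolution of `X` is itself a conflation of the induced structure, so it splits
when `X` is relatively projective. -/
lemma relativeProjective_iff (hM : IsClusterTilting n M) (hn : 2 ≤ n) {X : A}
    (hX : properDimLEOne M X) : relativeProjective M (properDimLEOne M) X ↔ M X := by
  refine ⟨fun h => ?_, fun h S hS _ _ _ x => hS.2 h x⟩
  obtain ⟨M₁, M₀, i, p, hp, h₁, h₀, hS⟩ := id hX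
  obtain ⟨y, hy⟩ := h _ hS (hM.le_properDimLEOne hn _ h₁) (hM.le_properDimLEOne hn _ h₀) hX (𝟙 X)
  exact hM.prop_of_retract ⟨y, p, hy⟩ h₀

lemma properDimLEOne_eq_top (hM : IsClusterTilting 2 M) : properDimLEOne M = ⊤ := by
  rw [← hM.rightPerp_eq_properDimLEOne le_rfl, rightPerp_one]

lemma stableProperDimLEOne_property_eq (hM : IsClusterTilting n M) (hn : 2 ≤ n) :
    (fun X : (properDimLEOne M).FullSubcategory =>
      relativeProjective M (properDimLEOne M) X.obj) = fun X => M X.obj := by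
  funext X
  exact propext (hM.relativeProjective_iff hn X.property)

lemma isFinitelyPresented_of_properDimLEOne {X : A} (hX : properDimLEOne M X) :
    isFinitelyPresented M.FullSubcategory ((restrictedYoneda M).obj X) := by
  obtain ⟨M₁, M₀, i, p, hp, h₁, h₀, hS⟩ := hX
  exact (isPresentation_of_isProperShortExact hS).isFinitelyPresented h₁ h₀

/-- The restricted Yoneda functor on the objects of proper dimension at most one. -/
abbrev properDimFunctor (hM : IsClusterTilting n M) (hn : 2 ≤ n) :
    (properDimLEOne M).FullSubcategory ⥤
      (projDimLEOne (C := M.FullSubcategory)).FullSubcategory :=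
  projDimLEOne.lift ((isFinitelyPresented M.FullSubcategory).lift
    ((properDimLEOne M).ι ⋙ restrictedYoneda M)
      fun X => isFinitelyPresented_of_properDimLEOne X.property)
    fun X => (hM.projDimLEOne_iff hn _).2 ⟨X.obj, X.property, ⟨Iso.refl _⟩⟩

lemma essSurj_properDimFunctor (hM : IsClusterTilting n M) (hn : 2 ≤ n) :
    (hM.properDimFunctor hn).EssSurj where
  mem_essImage F := by
    obtain ⟨X, hX, ⟨e⟩⟩ := (hM.projDimLEOne_iff hn F.obj).1 F.property
    exact ⟨⟨X, hX⟩, ⟨ObjectProperty.isoMk _ (ObjectProperty.isoMk _ e)⟩⟩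

lemma additive_properDimFunctor (hM : IsClusterTilting n M) (hn : 2 ≤ n) :
    (hM.properDimFunctor hn).Additive where
  map_add {_ _ f g} := ObjectProperty.hom_ext _ (ObjectProperty.hom_ext _
    ((restrictedYoneda M).map_add (f := f.hom) (g := g.hom)))

lemma nonempty_stableProjDimLEOne_equivalence (hM : IsClusterTilting n M) (hn : 2 ≤ n) :
    Nonempty (StableProjDimLEOne M.FullSubcategory ≌ FactorCategory M (properDimLEOne M)) := by
  have := hM.essSurj_properDimFunctor hn
  have := hM.additive_properDimFunctor hn
  have := hM.faithful_restrictedYoneda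
  have := hM.full_restrictedYoneda
  have : ObjectProperty.IsClosedUnderIsomorphisms
      (fun F : (projDimLEOne (C := M.FullSubcategory)).FullSubcategory => Projective F.obj) :=
    ⟨fun e h => Projective.of_iso (projDimLEOne.ι.mapIso e) h⟩
  obtain ⟨e⟩ := nonempty_stableCategory_equivalence (K := fun X => M X.obj)
    (L := fun F => Projective F.obj) (hM.properDimFunctor hn)
    fun X => (hM.projective_iff (Iso.refl _)).symm
  exact ⟨e.symm⟩

lemma nonempty_relativeStable_equivalence (hM : IsClusterTilting 2 M) :
    Nonempty (FactorCategory M (properDimLEOne M) ≌ RelativeStable M) := by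
  have : (properDimLEOne M).ι.EssSurj :=
    ⟨fun X => ⟨⟨X, by rw [hM.properDimLEOne_eq_top]; trivial⟩, ⟨Iso.refl _⟩⟩⟩
  have : (relativeProjective M ⊤).IsClosedUnderIsomorphisms :=
    ⟨fun e h S hS h₁ h₂ h₃ x => by
      obtain ⟨y, hy⟩ := h S hS h₁ h₂ h₃ (e.hom ≫ x)
      exact ⟨e.inv ≫ y, by rw [Category.assoc, hy, e.inv_hom_id_assoc]⟩⟩
  refine nonempty_stableCategory_equivalence (properDimLEOne M).ι fun X => ?_
  refine (hM.relativeProjective_iff le_rfl X.property).symm.trans (iff_of_eq ?_)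
  exact congrArg (fun E => relativeProjective M E X.obj) hM.properDimLEOne_eq_top

end IsClusterTilting

end ProperDimension

/-! ### Functors vanishing on projectives as defects of short exact sequences -/

section StableModules

variable {A : Type u} [Category.{v} A] [Abelian A] {n : ℕ} {M : ObjectProperty A}

variable (M) in
/-- The cokernel of `Hom(-, S.X₂) ⟶ Hom(-, S.X₃)`, as a functor of the short complex `S`. -/
noncomputable def defect : ShortComplex A ⥤ M.FullSubcategoryᵒᵖ ⥤ AddCommGrpCat.{v} where
  obj S := cokernel ((restrictedYoneda M).map S.g)
  map {S T} φ := cokernel.map _ _ ((restrictedYoneda M).map φ.τ₂) ((restrictedYoneda M).map φ.τ₃)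
    (by rw [← Functor.map_comp, ← Functor.map_comp, φ.comm₂₃])
  map_id S := by
    rw [← cancel_epi (cokernel.π _)]
    simp
  map_comp φ ψ := by
    rw [← cancel_epi (cokernel.π _)]
    simp

variable (M) in
/-- The projection of `Hom(-, S.X₃)` onto the defect of `S`. -/
noncomputable def defectπ (S : ShortComplex A) :
    (restrictedYoneda M).obj S.X₃ ⟶ (defect M).obj S :=
  cokernel.π ((restrictedYoneda M).map S.g)

lemma isPresentation_defectπ (S : ShortComplex A) : IsPresentation S.g (defectπ M S) :=
  isPresentation_cokernel S.g

instance (S : ShortComplex A) : Epi (defectπ M S) := (isPresentation_defectπ S).epi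

lemma defectπ_naturality {S T : ShortComplex A} (φ : S ⟶ T) :
    defectπ M S ≫ (defect M).map φ = (restrictedYoneda M).map φ.τ₃ ≫ defectπ M T :=
  cokernel.π_desc _ _ _

lemma map_comp_defectπ_eq_zero_iff {N : A} (hN : M N) (S : ShortComplex A) (c : N ⟶ S.X₃) :
    (restrictedYoneda M).map c ≫ defectπ M S = 0 ↔ ∃ h : N ⟶ S.X₂, h ≫ S.g = c := by
  constructor
  · intro h
    refine (isPresentation_defectπ S).exists_factor ⟨N, hN⟩ c ?_
    refine Eq.trans ?_ (congrArg (fun t : (restrictedYoneda M).obj N ⟶ _ =>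
      t.app (op ⟨N, hN⟩) (𝟙 N)) h)
    exact congrArg ((defectπ M S).app (op ⟨N, hN⟩)) (Category.id_comp c).symm
  · rintro ⟨h, rfl⟩
    rw [Functor.map_comp, Category.assoc, (isPresentation_defectπ S).map_comp_eq_zero, comp_zero]

lemma defect_map_eq_iff {S T : ShortComplex A} (h₃ : M S.X₃) (φ ψ : S ⟶ T) :
    (defect M).map φ = (defect M).map ψ ↔ ∃ h : S.X₃ ⟶ T.X₂, h ≫ T.g = (φ - ψ).τ₃ := by
  rw [← map_comp_defectπ_eq_zero_iff h₃, ShortComplex.sub_τ₃, Functor.map_sub,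
    Preadditive.sub_comp, sub_eq_zero, ← defectπ_naturality, ← defectπ_naturality, cancel_epi]

/-- The comparison theorem for projective presentations: lift `t` to the right terms, then to the
middle terms, and restrict to kernels. -/
lemma exists_defect_map_eq {S T : ShortComplex A} (hT : T.ShortExact) (h₂ : M S.X₂)
    (h₃ : M S.X₃) (t : (defect M).obj S ⟶ (defect M).obj T) : ∃ φ, (defect M).map φ = t := by
  obtain ⟨c, hc⟩ := exists_restrictedYoneda_lift (isPresentation_defectπ T).surjective
    ⟨S.X₃, h₃⟩ (defectπ M S ≫ t)
  obtain ⟨c, rfl⟩ := exists_restrictedYoneda_map_eq h₃ c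
  obtain ⟨b, hb⟩ := (map_comp_defectπ_eq_zero_iff h₂ T (S.g ≫ c)).1 (by
    rw [Functor.map_comp, Category.assoc, hc,
      reassoc_of% (isPresentation_defectπ S).map_comp_eq_zero, zero_comp])
  obtain ⟨a, ha⟩ := hT.exists_lift (S.f ≫ b) (by
    rw [Category.assoc, hb, S.zero_assoc, zero_comp])
  refine ⟨⟨a, b, c, ha, hb⟩, ?_⟩
  rw [← cancel_epi (defectπ M S), defectπ_naturality]
  exact hc

/-- A functor presented by `f` vanishes on projectives if and only if `f` is an epimorphism. -/
lemma vanishesOnProjectives_iff_epi [EnoughProjectives A] (hM : ∀ P : A, Projective P → M P)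
    {F : FPMod M.FullSubcategory} {N₁ N₀ : A} {f : N₁ ⟶ N₀}
    {p : (restrictedYoneda M).obj N₀ ⟶ F.obj} (h : IsPresentation f p) :
    vanishesOnProjectives M F ↔ Epi f := by
  constructor
  · intro hF
    -- Evaluating at a projective that covers `N₀` makes the covering map factor through `f`.
    let P : M.FullSubcategory := ⟨Projective.over N₀, hM _ inferInstance⟩
    have := AddCommGrpCat.subsingleton_of_isZero (hF P (Projective.projective_over N₀))
    obtain ⟨u, hu⟩ := h.exists_factor P (Projective.π N₀) (Subsingleton.elim _ _)
    exact epi_of_epi_fac hu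
  · intro _ P _
    refine @AddCommGrpCat.isZero_of_subsingleton _ (subsingleton_of_forall_eq 0 fun x => ?_)
    obtain ⟨(x : P.obj ⟶ N₀), rfl⟩ := h.surjective _ x
    rw [← Projective.factorThru_comp x f]
    exact h.app_comp _

variable (M) in
/-- The defect of a short exact sequence whose middle and right terms are in `M`. -/
noncomputable abbrev defectFunctor [EnoughProjectives A] (hM : ∀ P : A, Projective P → M P)
    (P : ObjectProperty A) :
    (shortExactWithTerms P M M).FullSubcategory ⥤ ModStable M :=
  (vanishesOnProjectives M).lift ((isFinitelyPresented M.FullSubcategory).lift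
    ((shortExactWithTerms P M M).ι ⋙ defect M)
      fun S => (isPresentation_defectπ S.obj).isFinitelyPresented S.property.2.2.1
        S.property.2.2.2)
    fun S => (vanishesOnProjectives_iff_epi hM (isPresentation_defectπ S.obj)).2
      S.property.1.epi_g

namespace IsClusterTilting

variable [EnoughProjectives A]

lemma full_defectFunctor (hM : ∀ P : A, Projective P → M P) (P : ObjectProperty A) :
    (defectFunctor M hM P).Full where
  map_surjective {S T} t := by
    obtain ⟨φ, hφ⟩ := exists_defect_map_eq T.property.1 S.property.2.2.1 S.property.2.2.2
      t.hom.hom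
    exact ⟨ObjectProperty.homMk φ, ObjectProperty.hom_ext _ (ObjectProperty.hom_ext _ hφ)⟩

lemma essSurj_defectFunctor (hM : ∀ P : A, Projective P → M P) {P : ObjectProperty A}
    (hP : ∀ S : ShortComplex A, S.ShortExact → M S.X₂ → M S.X₃ → P S.X₁) :
    (defectFunctor M hM P).EssSurj where
  mem_essImage F := by
    obtain ⟨_, N₁, N₀, f, p, h₁, h₀, h⟩ := isFinitelyPresented_iff.1 F.obj.property
    have := (vanishesOnProjectives_iff_epi hM h).1 F.property
    have hS : (ShortComplex.mk (kernel.ι f) f (kernel.condition f)).ShortExact :=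
      { exact := ShortComplex.exact_kernel f }
    obtain ⟨e⟩ := (isPresentation_cokernel f).nonempty_iso h
    exact ⟨⟨_, hS, hP _ hS h₁ h₀, h₁, h₀⟩,
      ⟨ObjectProperty.isoMk _ (ObjectProperty.isoMk _ e)⟩⟩

/-- A map of sequences is null-homotopic exactly when it vanishes on defects, and exactly when its
left term factors through `M`; so both functors are quotients by one congruence. -/
lemma nonempty_modStable_equivalence_leftPerp (hM : IsClusterTilting n M) (hn : 2 ≤ n) :
    Nonempty (ModStable M ≌ FactorCategory M (leftPerp (n - 1) M)) := by
  obtain ⟨m, rfl⟩ := Nat.exists_eq_add_of_le' hn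
  have hP : ∀ P : A, Projective P → M P := fun P _ => hM.prop_of_projective P
  have hQ : ∀ ⦃Y N : A⦄, M Y → M N → ExtVanishes Y N 1 :=
    fun Y N hY hN => hM.extVanishes hY hN one_pos (by omega)
  have := full_defectFunctor hP (leftPerp (m + 2 - 1) M)
  have := essSurj_defectFunctor hP (P := leftPerp (m + 2 - 1) M) fun S hS h₂ h₃ =>
    hM.leftPerp_X₁ hS h₂ (by omega) (hM.le_leftPerp le_rfl _ h₃)
  have := full_leftTerm (P := leftPerp (m + 2 - 1) M) hQ
  have := essSurj_leftTerm (P := leftPerp (m + 2 - 1) M) (M := M) (Q := M) fun X hX => by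
    obtain ⟨S, hS, hl, h₂, rfl⟩ := hM.exists_left_approximation X
    -- The cokernel of a left approximation of `X` lies in `leftPerp n M`, which is `M`.
    exact ⟨S, ⟨hS, hX, h₂, hM.prop_of_leftPerp (hM.leftPerp_X₃ hS hl h₂ (by omega) hX)⟩, rfl⟩
  refine nonempty_equivalence_of_full_of_essSurj (defectFunctor M hP (leftPerp (m + 2 - 1) M))
    (leftTerm (leftPerp (m + 2 - 1) M) M M) fun S T f g => ?_
  rw [leftTerm_map_eq_iff (hM.le_leftPerp (by omega)) hQ,
    exists_extension_τ₁_iff_exists_lift_τ₃ S.property.1 T.property.1]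
  refine Iff.trans ?_ (defect_map_eq_iff S.property.2.2.2 f.hom g.hom)
  exact ⟨fun h => congrArg (fun t => t.hom.hom) h,
    fun h => ObjectProperty.hom_ext _ (ObjectProperty.hom_ext _ h)⟩

lemma nonempty_modStable_equivalence (hM : IsClusterTilting n M) (hn : 2 ≤ n) :
    Nonempty (ModStable M ≌ FactorCategory M (properDimLEOne M)) := by
  obtain ⟨e⟩ := hM.nonempty_modStable_equivalence_leftPerp hn
  obtain ⟨e'⟩ := hM.nonempty_rightPerp_equivalence_leftPerp hn
  rw [hM.rightPerp_eq_properDimLEOne hn] at e'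
  exact ⟨e.trans e'.symm⟩

theorem equivalences (hM : IsClusterTilting n M) (hn : 2 ≤ n) :
    Nonempty (ModStable M ≌ StableProjDimLEOne M.FullSubcategory) ∧
      Nonempty (StableProjDimLEOne M.FullSubcategory ≌ StableProperDimLEOne M) ∧
      (n = 2 → (∀ X : A, properDimLEOne M X) ∧ Nonempty (ModStable M ≌ RelativeStable M) ∧
        Nonempty (StableProjDimLEOne M.FullSubcategory ≌ RelativeStable M)) := by
  obtain ⟨e⟩ := hM.nonempty_modStable_equivalence hn
  obtain ⟨e'⟩ := hM.nonempty_stableProjDimLEOne_equivalence hn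
  refine ⟨⟨e.trans e'.symm⟩, ?_, ?_⟩
  · unfold StableProperDimLEOne
    rw [hM.stableProperDimLEOne_property_eq hn]
    exact ⟨e'⟩
  · rintro rfl
    obtain ⟨e''⟩ := hM.nonempty_relativeStable_equivalence
    exact ⟨fun X => by rw [hM.properDimLEOne_eq_top]; trivial, ⟨e.trans e''⟩, ⟨e'.trans e''⟩⟩

end IsClusterTilting

end StableModules

end ClusterTilting

/-! ### Enough projectives among finitely generated modules -/

section FGModuleCat

variable {Λ : Type u} [Ring Λ] [IsNoetherianRing Λ]

lemma FGModuleCat.surjective_of_epi {X Y : FGModuleCat.{u} Λ} (e : X ⟶ Y) [Epi e] :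
    Function.Surjective e.hom.hom := by
  have : Epi ((forget₂ (FGModuleCat.{u} Λ) (ModuleCat.{u} Λ)).map e) := inferInstance
  exact (ModuleCat.epi_iff_surjective _).1 this

instance FGModuleCat.projective_of (P : Type u) [AddCommGroup P] [Module Λ P] [Module.Finite Λ P]
    [Module.Projective Λ P] : Projective (FGModuleCat.of Λ P) where
  factors {E X} f e _ := by
    obtain ⟨h, hh⟩ := Module.projective_lifting_property e.hom.hom f.hom.hom
      (FGModuleCat.surjective_of_epi e)
    exact ⟨ObjectProperty.homMk (ModuleCat.ofHom h), FGModuleCat.hom_ext hh⟩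

instance FGModuleCat.enoughProjectives : EnoughProjectives (FGModuleCat.{u} Λ) where
  presentation X := by
    obtain ⟨k, f, hf⟩ := Module.Finite.exists_fin' Λ X
    let φ : FGModuleCat.of Λ (Fin k → Λ) ⟶ X := ObjectProperty.homMk (ModuleCat.ofHom f)
    have : Epi ((ModuleCat.isFG Λ).ι.map φ) := (ModuleCat.epi_iff_surjective _).2 hf
    have : Epi φ := (ModuleCat.isFG Λ).ι.epi_of_epi_map this
    exact ⟨{ p := FGModuleCat.of Λ (Fin k → Λ), f := φ }⟩

end FGModuleCat

/-- `Λ` is an artin `R`-algebra, and `mod-Λ` is `FGModuleCat Λ` (an abelian category, since `Λ` is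
noetherian). -/
theorem mainTheorem9 (R : Type w) [CommRing R] [IsArtinianRing R]
    (Λ : Type u) [Ring Λ] [Algebra R Λ] [Module.Finite R Λ]
    (n : ℕ) (hn : 2 ≤ n) (M : ObjectProperty (FGModuleCat.{u} Λ))
    (hM : haveI : IsNoetherianRing Λ := IsNoetherianRing.of_finite R Λ
      ClusterTilting.IsClusterTilting n M) :
    Nonempty (ClusterTilting.ModStable M ≌
        ClusterTilting.StableProjDimLEOne M.FullSubcategory) ∧
      Nonempty (ClusterTilting.StableProjDimLEOne M.FullSubcategory ≌
        ClusterTilting.StableProperDimLEOne M) ∧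
      (n = 2 →
        (∀ X : FGModuleCat.{u} Λ, ClusterTilting.properDimLEOne M X) ∧
        Nonempty (ClusterTilting.ModStable M ≌ ClusterTilting.RelativeStable M) ∧
        Nonempty (ClusterTilting.StableProjDimLEOne M.FullSubcategory ≌
          ClusterTilting.RelativeStable M)) := by
  have : IsNoetherianRing Λ := IsNoetherianRing.of_finite R Λ
  exact hM.equivalences hn
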